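/- Write $L(x)=\log(\max(2,x))$, and for a real $n\times n$ matrix $A$ with singular values $\sigma_1,\dots,\sigma_n$ let $\|A\|_p=(\sum_i\sigma_i^p)^{1/p}$ be the Schatten-$p$ norm. **Theorem.** There is an absolute constant $C>0$ such that the following holds for all $n,m\in\mathbb{N}$, $p\in[1,2]$, $0<\alpha<1$, $\delta>0$ and $\varepsilon>0$. There is a randomized algorithm, depending only on $n,m,p,\alpha,\delta,\varepsilon$, that accesses a stream $A_1,\dots,A_m$ of real $n\times n$ matrices only through adaptively chosen matrix-vector multiplication queries (a query picks an index $j$ and a vector $x\in\mathbb{R}^n$ and is answered by $A_jx$), that outputs estimates $t_1,\dots,t_m$, where $t_i$ is output after queries to $A_1,\dots,A_i$ only, and that has the following two properties for every sequence $A_1,\dots,A_m$ with (1) $\|A_i\|_p\le 1$ for all $i\le m$ and (2) $\|A_{i+1}-A_i\|_p\le\alpha$ for all $i\le m-1$. * For each $i\in\{1,\dots,m\}$, $|t_i-\operatorname{tr}A_i|\le\varepsilon$ with probability at least $1-\delta$. * For every outcome of its random choices, the algorithm makes in total at most $$C\left((m\alpha+1)\,L(1/\alpha)^{1+p}\left(\frac{\sqrt{L(1/(\alpha\delta))}}{\varepsilon}\right)^{p}+m\,L(1/(\alpha\delta))\right)$$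 matrix-vector multiplication queries to $A_1,\dots,A_m$. In particular, for $\alpha\le 1/2$ and $\delta\le 1$ both $L$'s are ordinary logarithms, and the number of queries is $$O\left((m\alpha+1)\log^{1+p}(1/\alpha)\left(\frac{\sqrt{\log(1/(\alpha\delta))}}{\varepsilon}\right)^{p}+m\log(1/(\alpha\delta))\right)$$ with an absolute implied constant. -/

import Mathlib

open MeasureTheory

noncomputable section

/-- The Schatten `p`-norm `(∑ₖ σₖᵖ)^(1/p)` of a real square matrix, where `σ₀ ≥ σ₁ ≥ ⋯` are the
singular values of the linear map `x ↦ A x` on Euclidean space. -/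
def schattenNorm {n : ℕ} (p : ℝ) (A : Matrix (Fin n) (Fin n) ℝ) : ℝ :=
  (∑ k ∈ Finset.range n, (Matrix.toEuclideanLin A).singularValues k ^ p) ^ (1 / p)

/-- A deterministic adaptive program that accesses `n × n` matrices `A j` (`j : ι`) only through
matrix-vector products. It either stops and returns a value, or it submits a matrix index `j` and
a vector `x`, and continues in a way that may depend arbitrarily on the answer `A j x`. -/
inductive QueryProgram (n : ℕ) (ι β : Type) : Type
  | ret (b : β) : QueryProgram n ι β
  | query (j : ι) (x : Fin n → ℝ) (next : (Fin n → ℝ) → QueryProgram n ι β) : QueryProgram n ι β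

namespace QueryProgram

variable {n : ℕ} {ι β : Type}

/-- The value returned by a program on the matrices `A`. -/
def result (A : ι → Matrix (Fin n) (Fin n) ℝ) : QueryProgram n ι β → β
  | ret b => b
  | query j x next => result A (next ((A j).mulVec x))

/-- The number of matrix-vector queries that a program makes on the matrices `A`. -/
def cost (A : ι → Matrix (Fin n) (Fin n) ℝ) : QueryProgram n ι β → ℕ
  | ret _ => 0
  | query j x next => cost A (next ((A j).mulVec x)) + 1

end QueryProgram

/-- A deterministic algorithm on a stream `A 0, …, A (m - 1)` of `n × n` matrices. In step `i` it
may query the matrices `A j` with `j ≤ i`, with unrestricted memory of the earlier steps; it then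
updates its memory and outputs the `i`-th estimate. -/
structure StreamAlgorithm (n m : ℕ) where
  Mem : Type
  init : Mem
  step : (i : Fin m) → Mem → QueryProgram n {j : Fin m // j ≤ i} (Mem × ℝ)

namespace StreamAlgorithm

variable {n m : ℕ} (S : StreamAlgorithm n m) (A : Fin m → Matrix (Fin n) (Fin n) ℝ)

/-- The memory contents after the first `k` steps. -/
def memory : ℕ → S.Mem
  | 0 => S.init
  | k + 1 =>
    if h : k < m then ((S.step ⟨k, h⟩ (memory k)).result fun j => A j.1).1 else memory k

/-- The estimate that is output in step `i`. -/
def output (i : Fin m) : ℝ :=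
  ((S.step i (S.memory A i)).result fun j => A j.1).2

/-- The total number of matrix-vector queries over all steps. -/
def queries : ℕ :=
  ∑ i : Fin m, (S.step i (S.memory A i)).cost fun j => A j.1

end StreamAlgorithm

/-- A randomized algorithm on a stream of matrices: a deterministic one that depends on a random
seed `ω`, whose law `P` is independent of the input. The estimates are random variables. -/
structure RandomizedStreamAlgorithm (n m : ℕ) where
  Ω : Type
  [measurableSpace : MeasurableSpace Ω]
  P : Measure Ω
  [isProbabilityMeasure : IsProbabilityMeasure P]
  alg : Ω → StreamAlgorithm n m
  measurable_output : ∀ (A : Fin m → Matrix (Fin n) (Fin n) ℝ) (i : Fin m),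
    Measurable fun ω => (alg ω).output A i

attribute [instance] RandomizedStreamAlgorithm.measurableSpace
  RandomizedStreamAlgorithm.isProbabilityMeasure

/-- The logarithm with its argument truncated below at `2`: it equals `log x` for `x ≥ 2` and
`log 2` for `x ≤ 2`. -/
def truncLog (x : ℝ) : ℝ := Real.log (max 2 x)

end

/-! One matrix `B` with Schatten-p norm at most 1. Write F for the squared Frobenius norm and r =
p/(2-p). For a random sign vector g, projecting away y = Bg lowers F(B) by |Bᵀy|²/|y|², which is
typically about F(BᵀB)/F(B). By interpolation F(BᵀB) ≥ F(B)^(2+r), so with constant probability F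
falls by a constant times F^(1+r) (`exists_good_signs`). The potential exp(-48/Fʳ) then shrinks
geometrically in expectation, and by Markov's inequality N projections leave F of order N^(-(2-p)/p)
except with probability exponentially small in N (`expect_frobSq_residual_large_le`). The trace
removed by the projections is computed exactly with two queries each. The trace of the residual is
found by a median of R means of s Hutchinson estimates gᵀDg, whose variance is at most 2F(D). With R
of order log(1/δ) and N = Rs, balancing the residual against the sampling error gives Rs of order
(√log(1/δ)/η)^p + log(1/δ) (`exists_trace_estimator`).

The stream. Choose K with 2^K ≤ 1/α < 2^(K+1). If 2^K divides i, the trace of A_i is estimated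
afresh. Otherwise let 2^l be the largest power of 2 dividing i. The difference A_i - A_{i-2^l} has
norm at most 2^l α; its rescaled trace is estimated and added to the estimate at i - 2^l. The level
strictly increases along these links, so a chain has at most K+1 links, and each link receives a
share 1/(K+1) of ε and of δ; a union bound suffices (`measureReal_output_bad_le`). Level l occurs at
most m/2^l + 1 times, at a cost whose leading part is proportional to (2^l α)^p ≤ 2^l α. Hence every
level contributes O(mα+1) (`sum_levelScale_rpow_le`), and the K+1 levels together with the finer
accuracy ε/(K+1) produce the factor log^(1+p)(1/α). -/

section SchattenNorm

/-! ### Singular values, contractions and Schatten norms. -/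

open Matrix

variable {n : ℕ}

/-- The first `n` singular values of an `n × n` matrix. -/
noncomputable def sv (A : Matrix (Fin n) (Fin n) ℝ) (k : Fin n) : ℝ :=
  (Matrix.toEuclideanLin A).singularValues k

theorem sv_nonneg (A : Matrix (Fin n) (Fin n) ℝ) (k : Fin n) : 0 ≤ sv A k :=
  LinearMap.singularValues_nonneg _ _

theorem schattenNorm_eq (p : ℝ) (A : Matrix (Fin n) (Fin n) ℝ) :
    schattenNorm p A = (∑ k, sv A k ^ p) ^ (1 / p) := by
  rw [schattenNorm, Finset.sum_range]; rfl

theorem sum_sv_rpow_nonneg (p : ℝ) (A : Matrix (Fin n) (Fin n) ℝ) : 0 ≤ ∑ k, sv A k ^ p :=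
  Finset.sum_nonneg fun k _ => Real.rpow_nonneg (sv_nonneg A k) p

theorem schattenNorm_le_iff {p : ℝ} (hp : 1 ≤ p) {A : Matrix (Fin n) (Fin n) ℝ} {b : ℝ}
    (hb : 0 ≤ b) : schattenNorm p A ≤ b ↔ ∑ k, sv A k ^ p ≤ b ^ p := by
  rw [schattenNorm_eq, one_div,
    Real.rpow_inv_le_iff_of_pos (sum_sv_rpow_nonneg p A) hb (by linarith)]

/-- The singular value decomposition of a real square matrix. -/
theorem exists_svd (A : Matrix (Fin n) (Fin n) ℝ) :
    ∃ U V : Matrix (Fin n) (Fin n) ℝ, Uᵀ * U = 1 ∧ Vᵀ * V = 1 ∧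
      A = U * Matrix.diagonal (sv A) * Vᵀ := by
  set T := Matrix.toEuclideanLin A with hT
  have hn : Module.finrank ℝ (EuclideanSpace ℝ (Fin n)) = n := by simp
  set f := T.isSymmetric_adjoint_comp_self.eigenvectorBasis hn with hf
  have hev : ∀ k, (LinearMap.adjoint T ∘ₗ T) (f k) = (sv A k ^ 2) • f k := by
    intro k
    have := T.isSymmetric_adjoint_comp_self.apply_eigenvectorBasis hn k
    rw [← LinearMap.sq_singularValues_fin] at this
    exact this
  have hin : ∀ k l, inner ℝ (T (f k)) (T (f l)) = if k = l then sv A k ^ 2 else 0 := by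
    intro k l
    rw [← LinearMap.adjoint_inner_left]
    have h1 : LinearMap.adjoint T (T (f k)) = (sv A k ^ 2) • f k := hev k
    rw [h1, inner_smul_left, orthonormal_iff_ite.mp f.orthonormal k l]
    simp
  -- The images of the right singular vectors are orthogonal with lengths `sv A k`. The nonzero ones
  -- are normalised and completed to a basis, which supplies the left singular vectors.
  obtain ⟨b, hb⟩ := Orthonormal.exists_orthonormalBasis_extension_of_card_eq
    (𝕜 := ℝ) (E := EuclideanSpace ℝ (Fin n)) (ι := Fin n) (by simp)
    (v := fun k => (sv A k)⁻¹ • T (f k)) (s := {k | sv A k ≠ 0}) (by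
      rw [orthonormal_iff_ite]
      rintro ⟨k, hk⟩ ⟨l, hl⟩
      simp only [Set.domRestrict_apply, inner_smul_left, inner_smul_right, hin, Subtype.mk.injEq]
      simp only [Set.mem_ofPred_eq] at hk hl
      split_ifs with h
      · subst h; simp; field_simp
      · simp)
  have hTf : ∀ k, T (f k) = sv A k • b k := by
    intro k
    by_cases hk : sv A k = 0
    · have := hin k k
      simp only [hk] at this
      rw [hk, zero_smul]
      simpa using this
    · rw [hb k hk, smul_smul, mul_inv_cancel₀ hk, one_smul]
  have key : A * (Matrix.of fun i k => f k i) =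
      (Matrix.of fun i k => b k i) * Matrix.diagonal (sv A) := by
    ext i k
    have := congrArg (fun v : EuclideanSpace ℝ (Fin n) => v i) (hTf k)
    simp only [hT, PiLp.smul_apply, smul_eq_mul] at this
    rw [Matrix.mul_diagonal, Matrix.of_apply, mul_comm, ← this]
    simp [Matrix.mul_apply, Matrix.toLpLin_apply, Matrix.mulVec, dotProduct]
  have orth : ∀ g : OrthonormalBasis (Fin n) ℝ (EuclideanSpace ℝ (Fin n)),
      (Matrix.of fun i k => g k i)ᵀ * (Matrix.of fun i k => g k i) = 1 := by
    intro g
    ext k l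
    have := orthonormal_iff_ite.mp g.orthonormal l k
    rw [PiLp.inner_apply] at this
    simp only [Matrix.mul_apply, Matrix.transpose_apply, Matrix.of_apply, Matrix.one_apply]
    simpa [eq_comm, mul_comm] using this
  refine ⟨_, _, orth b, orth f, ?_⟩
  rw [← key, Matrix.mul_assoc, mul_eq_one_comm.mp (orth f), Matrix.mul_one]

/-- `K` and its transpose do not increase the Euclidean norm. -/
def IsContr (K : Matrix (Fin n) (Fin n) ℝ) : Prop :=
  (∀ x, K *ᵥ x ⬝ᵥ K *ᵥ x ≤ x ⬝ᵥ x) ∧ ∀ x, Kᵀ *ᵥ x ⬝ᵥ Kᵀ *ᵥ x ≤ x ⬝ᵥ x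

theorem IsContr.transpose {K : Matrix (Fin n) (Fin n) ℝ} (h : IsContr K) : IsContr Kᵀ :=
  ⟨h.2, by simpa using h.1⟩

theorem IsContr.mul {K L : Matrix (Fin n) (Fin n) ℝ} (hK : IsContr K) (hL : IsContr L) :
    IsContr (K * L) := by
  refine ⟨fun x => ?_, fun x => ?_⟩
  · rw [← Matrix.mulVec_mulVec]
    exact (hK.1 _).trans (hL.1 _)
  · rw [Matrix.transpose_mul, ← Matrix.mulVec_mulVec]
    exact (hL.2 _).trans (hK.2 _)

theorem mulVec_dotProduct_mulVec (K : Matrix (Fin n) (Fin n) ℝ) (x : Fin n → ℝ) :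
    K *ᵥ x ⬝ᵥ K *ᵥ x = x ⬝ᵥ (Kᵀ * K) *ᵥ x := by
  rw [← Matrix.mulVec_mulVec, Matrix.dotProduct_mulVec x, Matrix.vecMul_transpose]

theorem isContr_of_orthogonal {U : Matrix (Fin n) (Fin n) ℝ} (h : Uᵀ * U = 1) : IsContr U := by
  refine ⟨fun x => ?_, fun x => ?_⟩
  · rw [mulVec_dotProduct_mulVec, h, Matrix.one_mulVec]
  · rw [mulVec_dotProduct_mulVec, Matrix.transpose_transpose, mul_eq_one_comm.mp h,
      Matrix.one_mulVec]

theorem IsContr.sum_col_sq_le {K : Matrix (Fin n) (Fin n) ℝ} (h : IsContr K) (k : Fin n) :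
    ∑ i, K i k ^ 2 ≤ 1 := by
  simpa [dotProduct, sq, Pi.single_apply] using h.1 (Pi.single k 1)

theorem IsContr.sum_row_sq_le {K : Matrix (Fin n) (Fin n) ℝ} (h : IsContr K) (i : Fin n) :
    ∑ k, K i k ^ 2 ≤ 1 :=
  h.transpose.sum_col_sq_le i

/-- Jensen's inequality for sub-probability weights: the missing mass is placed on an extra point
with value 0. -/
theorem rpow_sum_mul_le {ι : Type*} [Fintype ι] (w x : ι → ℝ) {a : ℝ} (ha : 1 ≤ a)
    (hw : ∀ i, 0 ≤ w i) (hw1 : ∑ i, w i ≤ 1) (hx : ∀ i, 0 ≤ x i) :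
    (∑ i, w i * x i) ^ a ≤ ∑ i, w i * x i ^ a := by
  have := Real.rpow_arith_mean_le_arith_mean_rpow (Finset.univ : Finset (Option ι))
    (fun o => o.elim (1 - ∑ i, w i) w) (fun o => o.elim 0 x)
    (by rintro (_ | i) _ <;> simp [hw, hw1]) (by simp [Fintype.sum_option])
    (by rintro (_ | i) _ <;> simp [hx]) ha
  simpa [Fintype.sum_option, Real.zero_rpow (by linarith : a ≠ 0)] using this

/-- The variational bound for Schatten norms. -/
theorem sum_abs_diag_rpow_le {p : ℝ} (hp : 1 ≤ p) {W Z : Matrix (Fin n) (Fin n) ℝ}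
    (hW : IsContr W) (hZ : IsContr Z) (A : Matrix (Fin n) (Fin n) ℝ) :
    ∑ i, |(W * A * Z) i i| ^ p ≤ ∑ k, sv A k ^ p := by
  obtain ⟨U, V, hU, hV, hA⟩ := exists_svd A
  set K := W * U with hKdef
  set L := Vᵀ * Z with hLdef
  have hK : IsContr K := hW.mul (isContr_of_orthogonal hU)
  have hL : IsContr L := (isContr_of_orthogonal hV).transpose.mul hZ
  have hWAZ : W * A * Z = K * Matrix.diagonal (sv A) * L := by
    conv_lhs => rw [hA]
    simp only [hKdef, hLdef, Matrix.mul_assoc]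
  -- The weights `(K i k ^ 2 + L k i ^ 2) / 2` have row and column sums at most 1. Jensen uses the
  -- rows; the columns are used after exchanging the sums.
  have hentry : ∀ i, |(W * A * Z) i i| ≤ ∑ k, (K i k ^ 2 + L k i ^ 2) / 2 * sv A k := by
    intro i
    rw [hWAZ, Matrix.mul_apply]
    refine (Finset.abs_sum_le_sum_abs _ _).trans (Finset.sum_le_sum fun k _ => ?_)
    rw [Matrix.mul_diagonal, abs_mul, abs_mul, abs_of_nonneg (sv_nonneg A k)]
    have h := two_mul_le_add_sq |K i k| |L k i|
    rw [sq_abs, sq_abs] at h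
    nlinarith [sv_nonneg A k, mul_le_mul_of_nonneg_right h (sv_nonneg A k)]
  calc ∑ i, |(W * A * Z) i i| ^ p
      ≤ ∑ i, ∑ k, (K i k ^ 2 + L k i ^ 2) / 2 * sv A k ^ p := by
        refine Finset.sum_le_sum fun i _ => ?_
        refine (Real.rpow_le_rpow (abs_nonneg _) (hentry i) (by linarith)).trans ?_
        refine rpow_sum_mul_le _ _ hp (fun k => by positivity) ?_ (sv_nonneg A)
        rw [← Finset.sum_div, Finset.sum_add_distrib]
        linarith [hK.sum_row_sq_le i, hL.sum_col_sq_le i]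
    _ = ∑ k, (∑ i, (K i k ^ 2 + L k i ^ 2) / 2) * sv A k ^ p := by
        rw [Finset.sum_comm]
        exact Finset.sum_congr rfl fun k _ => (Finset.sum_mul _ _ _).symm
    _ ≤ ∑ k, sv A k ^ p := by
        refine Finset.sum_le_sum fun k _ =>
          mul_le_of_le_one_left (Real.rpow_nonneg (sv_nonneg A k) p) ?_
        rw [← Finset.sum_div, Finset.sum_add_distrib]
        linarith [hK.sum_col_sq_le k, hL.sum_row_sq_le k]

theorem exists_contr_diag_eq_sv (A : Matrix (Fin n) (Fin n) ℝ) :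
    ∃ W Z : Matrix (Fin n) (Fin n) ℝ, IsContr W ∧ IsContr Z ∧ ∀ k, (W * A * Z) k k = sv A k := by
  obtain ⟨U, V, hU, hV, hA⟩ := exists_svd A
  refine ⟨Uᵀ, V, (isContr_of_orthogonal hU).transpose, isContr_of_orthogonal hV, fun k => ?_⟩
  have : Uᵀ * A * V = Matrix.diagonal (sv A) := by
    conv_lhs => rw [hA]
    rw [show Uᵀ * (U * Matrix.diagonal (sv A) * Vᵀ) * V =
      (Uᵀ * U) * Matrix.diagonal (sv A) * (Vᵀ * V) by simp only [Matrix.mul_assoc], hU, hV]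
    simp
  rw [this, Matrix.diagonal_apply_eq]

/-- In the variational bound the contraction `E` is absorbed into `W`. This keeps the Schatten
hypothesis valid for every residual of the range finder. -/
theorem sum_sv_rpow_contr_mul_le {p : ℝ} (hp : 1 ≤ p) {E : Matrix (Fin n) (Fin n) ℝ}
    (hE : IsContr E) (A : Matrix (Fin n) (Fin n) ℝ) :
    ∑ k, sv (E * A) k ^ p ≤ ∑ k, sv A k ^ p := by
  obtain ⟨W, Z, hW, hZ, h⟩ := exists_contr_diag_eq_sv (E * A)
  refine le_trans (Finset.sum_le_sum fun k _ => ?_) (sum_abs_diag_rpow_le hp (hW.mul hE) hZ A)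
  rw [← h k, ← abs_of_nonneg ((sv_nonneg (E * A) k).trans_eq (h k).symm), ← Matrix.mul_assoc]

/-- With `W` and `Z` diagonalising `A + B`, this is Minkowski's inequality for the diagonals
followed by the variational bound for each summand. -/
theorem schattenNorm_add_le {p : ℝ} (hp : 1 ≤ p) (A B : Matrix (Fin n) (Fin n) ℝ) :
    schattenNorm p (A + B) ≤ schattenNorm p A + schattenNorm p B := by
  obtain ⟨W, Z, hW, hZ, h⟩ := exists_contr_diag_eq_sv (A + B)
  have h0 : (0 : ℝ) ≤ 1 / p := by positivity
  simp only [schattenNorm_eq]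
  calc (∑ k, sv (A + B) k ^ p) ^ (1 / p)
      ≤ (∑ k, (|(W * A * Z) k k| + |(W * B * Z) k k|) ^ p) ^ (1 / p) := by
        refine Real.rpow_le_rpow (sum_sv_rpow_nonneg p _) (Finset.sum_le_sum fun k _ => ?_) h0
        refine Real.rpow_le_rpow (sv_nonneg _ k) ?_ (by linarith)
        rw [← h k, Matrix.mul_add, Matrix.add_mul, Matrix.add_apply]
        exact add_le_add (le_abs_self _) (le_abs_self _)
    _ ≤ (∑ k, |(W * A * Z) k k| ^ p) ^ (1 / p) + (∑ k, |(W * B * Z) k k| ^ p) ^ (1 / p) :=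
        Real.Lp_add_le_of_nonneg _ hp (fun _ _ => abs_nonneg _) (fun _ _ => abs_nonneg _)
    _ ≤ _ := by
        refine add_le_add (Real.rpow_le_rpow ?_ (sum_abs_diag_rpow_le hp hW hZ A) h0)
          (Real.rpow_le_rpow ?_ (sum_abs_diag_rpow_le hp hW hZ B) h0) <;>
        exact Finset.sum_nonneg fun k _ => Real.rpow_nonneg (abs_nonneg _) _

theorem sum_sv_rpow_smul_le {p : ℝ} (hp : 1 ≤ p) {c : ℝ} (hc : 0 ≤ c)
    (A : Matrix (Fin n) (Fin n) ℝ) : ∑ k, sv (c • A) k ^ p ≤ c ^ p * ∑ k, sv A k ^ p := by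
  obtain ⟨W, Z, hW, hZ, h⟩ := exists_contr_diag_eq_sv (c • A)
  refine le_trans (Finset.sum_le_sum fun k _ => ?_)
    ((Finset.mul_sum _ _ _).symm.le.trans
      (mul_le_mul_of_nonneg_left (sum_abs_diag_rpow_le hp hW hZ A) (Real.rpow_nonneg hc p)))
  rw [← Real.mul_rpow hc (abs_nonneg _)]
  refine Real.rpow_le_rpow (sv_nonneg _ k) ?_ (by linarith)
  rw [← h k, Matrix.mul_smul, Matrix.smul_mul, Matrix.smul_apply, smul_eq_mul]
  exact mul_le_mul_of_nonneg_left (le_abs_self _) hc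

/-! ### Frobenius norm and interpolation. -/

/-- The squared Frobenius norm. -/
noncomputable def frobSq (A : Matrix (Fin n) (Fin n) ℝ) : ℝ := ∑ i, ∑ j, A i j ^ 2

theorem frobSq_nonneg (A : Matrix (Fin n) (Fin n) ℝ) : 0 ≤ frobSq A :=
  Finset.sum_nonneg fun _ _ => Finset.sum_nonneg fun _ _ => sq_nonneg _

theorem frobSq_eq_trace (A : Matrix (Fin n) (Fin n) ℝ) : frobSq A = (Aᵀ * A).trace := by
  simp only [frobSq, Matrix.trace, Matrix.diag, Matrix.mul_apply, Matrix.transpose_apply, sq]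
  exact Finset.sum_comm

theorem transpose_mul_self_eq (A : Matrix (Fin n) (Fin n) ℝ) :
    ∃ V : Matrix (Fin n) (Fin n) ℝ, Vᵀ * V = 1 ∧
      Aᵀ * A = V * Matrix.diagonal (fun k => sv A k ^ 2) * Vᵀ := by
  obtain ⟨U, V, hU, hV, hA⟩ := exists_svd A
  refine ⟨V, hV, ?_⟩
  conv_lhs => rw [hA]
  rw [Matrix.transpose_mul, Matrix.transpose_mul, Matrix.transpose_transpose,
    Matrix.diagonal_transpose, show V * (Matrix.diagonal (sv A) * Uᵀ) *
      (U * Matrix.diagonal (sv A) * Vᵀ) = V * (Matrix.diagonal (sv A) * (Uᵀ * U) *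
      Matrix.diagonal (sv A)) * Vᵀ by simp only [Matrix.mul_assoc], hU, Matrix.mul_one,
    Matrix.diagonal_mul_diagonal]
  simp only [sq]

theorem frobSq_eq_sum_sv (A : Matrix (Fin n) (Fin n) ℝ) : frobSq A = ∑ k, sv A k ^ 2 := by
  obtain ⟨V, hV, h⟩ := transpose_mul_self_eq A
  rw [frobSq_eq_trace, h, Matrix.trace_mul_comm, ← Matrix.mul_assoc, hV, Matrix.one_mul,
    Matrix.trace_diagonal]

theorem frobSq_gram_eq_sum_sv (A : Matrix (Fin n) (Fin n) ℝ) :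
    frobSq (Aᵀ * A) = ∑ k, sv A k ^ 4 := by
  obtain ⟨V, hV, h⟩ := transpose_mul_self_eq A
  rw [frobSq_eq_trace, h]
  rw [Matrix.transpose_mul, Matrix.transpose_mul, Matrix.transpose_transpose,
    Matrix.diagonal_transpose, Matrix.trace_mul_comm,
    show V * Matrix.diagonal (fun k => sv A k ^ 2) * Vᵀ *
      (V * (Matrix.diagonal (fun k => sv A k ^ 2) * Vᵀ)) = V * (Matrix.diagonal
      (fun k => sv A k ^ 2) * (Vᵀ * V) * Matrix.diagonal (fun k => sv A k ^ 2) * Vᵀ) by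
      simp only [Matrix.mul_assoc], Matrix.trace_mul_comm, hV, Matrix.mul_one, Matrix.mul_assoc,
    hV, Matrix.mul_one, Matrix.diagonal_mul_diagonal, Matrix.trace_diagonal]
  exact Finset.sum_congr rfl fun k _ => by ring

theorem sv_le_one {p : ℝ} (hp : 1 ≤ p) {A : Matrix (Fin n) (Fin n) ℝ}
    (h : ∑ k, sv A k ^ p ≤ 1) (k : Fin n) : sv A k ≤ 1 := by
  by_contra! hk
  have h1 : 1 < sv A k ^ p := Real.one_lt_rpow hk (by linarith)
  have h2 := Finset.single_le_sum (f := fun k => sv A k ^ p)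
    (fun k _ => Real.rpow_nonneg (sv_nonneg A k) p) (Finset.mem_univ k)
  linarith

theorem frobSq_le_one {p : ℝ} (hp : 1 ≤ p) (hp2 : p ≤ 2) {A : Matrix (Fin n) (Fin n) ℝ}
    (h : ∑ k, sv A k ^ p ≤ 1) : frobSq A ≤ 1 := by
  rw [frobSq_eq_sum_sv]
  refine le_trans (Finset.sum_le_sum fun k _ => ?_) h
  rw [← Real.rpow_natCast]
  rcases (sv_nonneg A k).eq_or_lt with h0 | h0
  · rw [← h0, Real.zero_rpow (by norm_num), Real.zero_rpow (by linarith)]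
  · exact Real.rpow_le_rpow_of_exponent_ge h0 (sv_le_one hp h k) (by simpa using hp2)

/-- Interpolation between the Schatten norms of orders `p`, `2` and `4`. -/
theorem frobSq_rpow_le_frobSq_gram {p : ℝ} (hp : 1 ≤ p) (hp2 : p < 2)
    {A : Matrix (Fin n) (Fin n) ℝ} (h : ∑ k, sv A k ^ p ≤ 1) :
    frobSq A ^ (2 + p / (2 - p)) ≤ frobSq (Aᵀ * A) := by
  have h2 : 0 < 2 - p := by linarith
  have hmul : ∀ k (a : ℝ), 0 < a → sv A k ^ p * sv A k ^ a = sv A k ^ (p + a) := by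
    intro k a ha
    rw [Real.rpow_add_of_nonneg (sv_nonneg A k) (by linarith) ha.le]
  -- Jensen with weights σᵖ and values σ^(2-p); the exponent a = 2 + p/(2-p) is the one with (2-p)a
  -- = 4-p.
  have := rpow_sum_mul_le (fun k => sv A k ^ p) (fun k => sv A k ^ (2 - p))
    (a := 2 + p / (2 - p)) (by have := div_nonneg (by linarith : 0 ≤ p) h2.le; linarith)
    (fun k => Real.rpow_nonneg (sv_nonneg A k) p) h
    (fun k => Real.rpow_nonneg (sv_nonneg A k) _)
  rw [frobSq_eq_sum_sv, frobSq_gram_eq_sum_sv]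
  convert this using 2 with k
  · refine Finset.sum_congr rfl fun k _ => ?_
    rw [hmul k _ h2, ← Real.rpow_natCast]
    norm_num
  · rw [← Real.rpow_mul (sv_nonneg A _), hmul _ _ (by positivity), ← Real.rpow_natCast]
    congr 1
    field_simp
    push_cast
    ring

end SchattenNorm
-- Moments of quadratic forms in random signs, and one step of the range finder.
section RandomSigns

open Matrix Finset
open scoped BigOperators

variable {n : ℕ}

/-- The vector of signs encoded by a Boolean vector. -/
def signVec (g : Fin n → Bool) : Fin n → ℝ := fun i => if g i then 1 else -1

theorem signVec_mul_self (g : Fin n → Bool) (i : Fin n) : signVec g i * signVec g i = 1 := by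
  unfold signVec; split_ifs <;> norm_num

/-- Flipping the sign of one coordinate. -/
def flipEquiv (a : Fin n) : (Fin n → Bool) ≃ (Fin n → Bool) :=
  Function.Involutive.toPerm (fun g => Function.update g a (!g a)) (by intro g; simp)

theorem flipEquiv_apply (a : Fin n) (g : Fin n → Bool) :
    flipEquiv a g = Function.update g a (!g a) := rfl

theorem signVec_flip (a : Fin n) (g : Fin n → Bool) (i : Fin n) :
    signVec (flipEquiv a g) i = if i = a then -signVec g i else signVec g i := by
  by_cases h : i = a
  · subst h
    cases hg : g i <;> simp [signVec, flipEquiv_apply, hg]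
  · simp [signVec, flipEquiv_apply, h]

theorem expect_eq_zero_of_flip (a : Fin n) (f : (Fin n → Bool) → ℝ)
    (h : ∀ g, f (flipEquiv a g) = -f g) : 𝔼 g, f g = 0 := by
  have := Fintype.expect_equiv (flipEquiv a) (fun g => -f g) f (fun g => (h g).symm)
  rw [expect_neg_distrib] at this
  linarith

theorem expect_signVec_mul {i j : Fin n} (h : i ≠ j) :
    𝔼 g : Fin n → Bool, signVec g i * signVec g j = 0 :=
  expect_eq_zero_of_flip i _ fun g => by simp [signVec_flip, h.symm]

theorem expect_signVec_four {i j k l : Fin n} (hij : i ≠ j) (hkl : k ≠ l) :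
    𝔼 g : Fin n → Bool, signVec g i * signVec g j * (signVec g k * signVec g l) =
      (if i = k ∧ j = l then 1 else 0) + (if i = l ∧ j = k then 1 else 0) := by
  by_cases h1 : i = k ∧ j = l
  · obtain ⟨rfl, rfl⟩ := h1
    have : ∀ g : Fin n → Bool,
        signVec g i * signVec g j * (signVec g i * signVec g j) = 1 := fun g => by
      rw [mul_mul_mul_comm, signVec_mul_self, signVec_mul_self, one_mul]
    simp [this, hij]
  by_cases h2 : i = l ∧ j = k
  · obtain ⟨rfl, rfl⟩ := h2
    have : ∀ g : Fin n → Bool,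
        signVec g i * signVec g j * (signVec g j * signVec g i) = 1 := fun g => by
      rw [mul_comm (signVec g j) (signVec g i), mul_mul_mul_comm, signVec_mul_self,
        signVec_mul_self, one_mul]
    simp [this, hij]
  rw [if_neg h1, if_neg h2, add_zero]
  by_cases hi : i = k ∨ i = l
  -- Outside the two pairings some index occurs exactly once in the product, and flipping its sign
  -- kills the mean.
  · have hj : j ≠ k ∧ j ≠ l := by grind
    exact expect_eq_zero_of_flip j _ fun g => by
      simp [signVec_flip, hij, hj.1.symm, hj.2.symm]
  · push Not at hi
    exact expect_eq_zero_of_flip i _ fun g => by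
      simp [signVec_flip, hij.symm, hi.1.symm, hi.2.symm]

theorem quadForm_sub_trace (D : Matrix (Fin n) (Fin n) ℝ) (g : Fin n → Bool) :
    signVec g ⬝ᵥ D *ᵥ signVec g - D.trace =
      ∑ i, ∑ j, (if i = j then 0 else D i j) * (signVec g i * signVec g j) := by
  rw [Matrix.trace, dotProduct, ← Finset.sum_sub_distrib]
  refine Finset.sum_congr rfl fun i _ => ?_
  rw [mulVec, dotProduct, Finset.mul_sum, ← Finset.add_sum_erase _ _ (Finset.mem_univ i),
    ← Finset.add_sum_erase univ (fun j => (if i = j then 0 else D i j) * _) (Finset.mem_univ i),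
    Matrix.diag_apply]
  rw [mul_left_comm, signVec_mul_self]
  simp only [if_true, mul_one, add_sub_cancel_left, zero_add]
  refine Finset.sum_congr rfl fun j hj => ?_
  rw [if_neg (Finset.ne_of_mem_erase hj).symm]
  ring

/-- The mean of the Hutchinson estimator. -/
theorem expect_quadForm_sub_trace (D : Matrix (Fin n) (Fin n) ℝ) :
    𝔼 g : Fin n → Bool, (signVec g ⬝ᵥ D *ᵥ signVec g - D.trace) = 0 := by
  simp only [quadForm_sub_trace]
  rw [expect_sum_comm]
  refine Finset.sum_eq_zero fun i _ => ?_
  rw [expect_sum_comm]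
  refine Finset.sum_eq_zero fun j _ => ?_
  rw [← mul_expect]
  by_cases h : i = j
  · simp [h]
  · rw [expect_signVec_mul h, mul_zero]

/-- The variance of the Hutchinson estimator. -/
theorem expect_quadForm_sub_trace_sq_le (D : Matrix (Fin n) (Fin n) ℝ) :
    𝔼 g : Fin n → Bool, (signVec g ⬝ᵥ D *ᵥ signVec g - D.trace) ^ 2 ≤ 2 * frobSq D := by
  set O : Fin n → Fin n → ℝ := fun i j => if i = j then 0 else D i j with hO
  have hsq : ∀ g : Fin n → Bool, (signVec g ⬝ᵥ D *ᵥ signVec g - D.trace) ^ 2 =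
      ∑ i, ∑ j, ∑ k, ∑ l, O i j * O k l *
        (signVec g i * signVec g j * (signVec g k * signVec g l)) := by
    intro g
    rw [quadForm_sub_trace, sq, Finset.sum_mul]
    refine Finset.sum_congr rfl fun i _ => ?_
    rw [Finset.sum_mul]
    refine Finset.sum_congr rfl fun j _ => ?_
    rw [Finset.mul_sum]
    refine Finset.sum_congr rfl fun k _ => ?_
    rw [Finset.mul_sum]
    exact Finset.sum_congr rfl fun l _ => by simp only [hO]; ring
  have hE : 𝔼 g : Fin n → Bool, (signVec g ⬝ᵥ D *ᵥ signVec g - D.trace) ^ 2 =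
      ∑ i, ∑ j, (O i j * O i j + O i j * O j i) := by
    simp only [hsq]
    rw [expect_sum_comm]
    refine Finset.sum_congr rfl fun i _ => ?_
    rw [expect_sum_comm]
    refine Finset.sum_congr rfl fun j _ => ?_
    have : ∀ k l, 𝔼 g : Fin n → Bool, O i j * O k l *
        (signVec g i * signVec g j * (signVec g k * signVec g l)) =
        (if i = k then if j = l then O i j * O k l else 0 else 0) +
        (if i = l then if j = k then O i j * O k l else 0 else 0) := by
      intro k l
      rw [← mul_expect]
      by_cases hij : i = j
      · simp [hO, hij]
      by_cases hkl : k = l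
      · simp [hO, hkl]
      rw [expect_signVec_four hij hkl]
      simp only [mul_add, ite_and, mul_ite, mul_one, mul_zero]
    have hkl : 𝔼 g : Fin n → Bool, ∑ k, ∑ l, O i j * O k l *
        (signVec g i * signVec g j * (signVec g k * signVec g l)) =
        ∑ k, ∑ l, ((if i = k then if j = l then O i j * O k l else 0 else 0) +
        (if i = l then if j = k then O i j * O k l else 0 else 0)) := by
      rw [expect_sum_comm]
      refine Finset.sum_congr rfl fun k _ => ?_
      rw [expect_sum_comm]
      exact Finset.sum_congr rfl fun l _ => this k l
    rw [hkl]
    simp only [Finset.sum_add_distrib]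
    congr 1
    · simp
    · rw [Finset.sum_comm]
      simp
  rw [hE]
  calc ∑ i, ∑ j, (O i j * O i j + O i j * O j i)
      ≤ ∑ i, ∑ j, ((3 / 2) * O i j ^ 2 + (1 / 2) * O j i ^ 2) :=
        Finset.sum_le_sum fun i _ => Finset.sum_le_sum fun j _ => by
          nlinarith [sq_nonneg (O i j - O j i)]
    _ = 2 * ∑ i, ∑ j, O i j ^ 2 := by
        simp only [Finset.sum_add_distrib, ← Finset.mul_sum]
        rw [Finset.sum_comm (f := fun i j => O j i ^ 2)]
        ring
    _ ≤ 2 * frobSq D := by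
        refine mul_le_mul_of_nonneg_left (Finset.sum_le_sum fun i _ =>
          Finset.sum_le_sum fun j _ => ?_) (by norm_num)
        simp only [hO]
        split_ifs
        · simpa using sq_nonneg (D i j)
        · rfl

theorem frobSq_gram_le (S : Matrix (Fin n) (Fin n) ℝ) : frobSq (Sᵀ * S) ≤ frobSq S ^ 2 := by
  have h : frobSq S = ∑ j, ∑ i, S i j ^ 2 := Finset.sum_comm
  rw [sq (frobSq S)]
  nth_rewrite 1 [h]
  rw [h, frobSq, Finset.sum_mul_sum]
  refine Finset.sum_le_sum fun i _ => Finset.sum_le_sum fun j _ => ?_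
  rw [Matrix.mul_apply]
  exact Finset.sum_mul_sq_le_sq_mul_sq _ _ _

theorem expect_normSq (S : Matrix (Fin n) (Fin n) ℝ) :
    𝔼 g : Fin n → Bool, S *ᵥ signVec g ⬝ᵥ S *ᵥ signVec g = frobSq S := by
  have := expect_quadForm_sub_trace (Sᵀ * S)
  rw [expect_sub_distrib, Fintype.expect_const, sub_eq_zero] at this
  simp only [mulVec_dotProduct_mulVec, frobSq_eq_trace, this]

/-- |Sg|² is the Hutchinson estimator of SᵀS, so its second moment is the squared mean plus a
variance of at most 2 `frobSq (Sᵀ * S)`. -/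
theorem expect_normSq_sq_le (S : Matrix (Fin n) (Fin n) ℝ) :
    𝔼 g : Fin n → Bool, (S *ᵥ signVec g ⬝ᵥ S *ᵥ signVec g) ^ 2 ≤ 3 * frobSq S ^ 2 := by
  have h1 := expect_quadForm_sub_trace_sq_le (Sᵀ * S)
  have h2 : 𝔼 g : Fin n → Bool, (S *ᵥ signVec g ⬝ᵥ S *ᵥ signVec g) ^ 2 =
      𝔼 g : Fin n → Bool, ((signVec g ⬝ᵥ (Sᵀ * S) *ᵥ signVec g - (Sᵀ * S).trace) ^ 2 +
        (2 * frobSq S) * (S *ᵥ signVec g ⬝ᵥ S *ᵥ signVec g) - frobSq S ^ 2) :=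
    Finset.expect_congr rfl fun g _ => by
      rw [← mulVec_dotProduct_mulVec, ← frobSq_eq_trace]; ring
  rw [h2, expect_sub_distrib, expect_add_distrib, ← mul_expect, expect_normSq,
    Fintype.expect_const]
  nlinarith [frobSq_gram_le S]

/-- A Paley–Zygmund bound. On the event, Z ≤ Z²/(12μ) + 3μ by AM–GM; taking means gives μ ≤ μ/2 +
μ/4 + 3μ·Pr. -/
theorem one_twelfth_le_expect {α : Type*} [Fintype α] [Nonempty α] (Z : α → ℝ) {μ : ℝ}
    (hμ : 0 < μ) (hZ1 : 𝔼 a, Z a = μ) (hZ2 : 𝔼 a, Z a ^ 2 ≤ 3 * μ ^ 2) :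
    1 / 12 ≤ 𝔼 a, (if μ / 2 ≤ Z a then (1 : ℝ) else 0) := by
  have h : 𝔼 a, Z a ≤
      𝔼 a, (μ / 2 + Z a ^ 2 / (12 * μ) + 3 * μ * (if μ / 2 ≤ Z a then (1 : ℝ) else 0)) := by
    refine expect_le_expect fun a _ => ?_
    have h0 : 0 ≤ Z a ^ 2 / (12 * μ) := by positivity
    split_ifs with hc
    · have : Z a ≤ Z a ^ 2 / (12 * μ) + 3 * μ := by
        rw [← sub_le_iff_le_add, le_div_iff₀ (by positivity)]
        nlinarith [sq_nonneg (Z a - 6 * μ)]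
      linarith
    · linarith
  rw [expect_add_distrib, expect_add_distrib, Fintype.expect_const, ← expect_div, ← mul_expect,
    hZ1] at h
  have h3 : (𝔼 a, Z a ^ 2) / (12 * μ) ≤ μ / 4 := by
    rw [div_le_iff₀ (by positivity)]; nlinarith
  have h4 : μ * (1 / 12) ≤ μ * 𝔼 a, (if μ / 2 ≤ Z a then (1 : ℝ) else 0) := by linarith
  exact le_of_mul_le_mul_left h4 hμ

theorem expect_ite_lt_le {α : Type*} [Fintype α] (Z : α → ℝ) {c : ℝ} (hc : 0 < c)
    (hZ : ∀ a, 0 ≤ Z a) : 𝔼 a, (if c < Z a then (1 : ℝ) else 0) ≤ (𝔼 a, Z a) / c := by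
  rw [expect_div]
  refine expect_le_expect fun a _ => ?_
  split_ifs with h
  · rw [le_div_iff₀ hc]; linarith
  · exact div_nonneg (hZ a) hc.le

/-- The orthogonal projection onto the orthogonal complement of `y`. -/
noncomputable def projCompl (y : Fin n → ℝ) : Matrix (Fin n) (Fin n) ℝ :=
  1 - (y ⬝ᵥ y)⁻¹ • vecMulVec y y

theorem projCompl_transpose (y : Fin n → ℝ) : (projCompl y)ᵀ = projCompl y := by
  simp [projCompl, Matrix.transpose_sub, Matrix.transpose_smul, Matrix.transpose_vecMulVec]

/-- Since this also holds at 0, the formulas for `projCompl y` need no case `y = 0`, where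
`projCompl y` is the identity. -/
theorem inv_mul_sq_mul (a : ℝ) : a⁻¹ ^ 2 * a = a⁻¹ := by
  rcases eq_or_ne a 0 with rfl | h
  · simp
  · field_simp

theorem isContr_projCompl (y : Fin n → ℝ) : IsContr (projCompl y) := by
  have h : ∀ x, projCompl y *ᵥ x ⬝ᵥ projCompl y *ᵥ x ≤ x ⬝ᵥ x := by
    intro x
    have h1 : projCompl y *ᵥ x = x - ((y ⬝ᵥ y)⁻¹ * (y ⬝ᵥ x)) • y := by
      rw [projCompl, Matrix.sub_mulVec, Matrix.one_mulVec, Matrix.smul_mulVec,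
        Matrix.vecMulVec_mulVec, mul_smul]
      simp
    rw [h1]
    simp only [sub_dotProduct, dotProduct_sub, smul_dotProduct, dotProduct_smul, smul_eq_mul]
    rw [dotProduct_comm x y]
    have h2 := inv_mul_sq_mul (y ⬝ᵥ y)
    have h3 : 0 ≤ (y ⬝ᵥ y)⁻¹ * (y ⬝ᵥ x) ^ 2 := by
      have : 0 ≤ y ⬝ᵥ y := Finset.sum_nonneg fun i _ => mul_self_nonneg _
      positivity
    linear_combination h3 + (y ⬝ᵥ x) ^ 2 * h2
  exact ⟨h, by rw [projCompl_transpose]; exact h⟩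

theorem isContr_one : IsContr (1 : Matrix (Fin n) (Fin n) ℝ) :=
  isContr_of_orthogonal (by simp)

theorem frobSq_projCompl_mul (y : Fin n → ℝ) (B : Matrix (Fin n) (Fin n) ℝ) :
    frobSq (projCompl y * B) = frobSq B - (Bᵀ *ᵥ y ⬝ᵥ Bᵀ *ᵥ y) / (y ⬝ᵥ y) := by
  set z := Bᵀ *ᵥ y with hz
  set c := (y ⬝ᵥ y)⁻¹ with hc
  have hent : ∀ i j, (projCompl y * B) i j = B i j - c * (y i * z j) := by
    intro i j
    rw [projCompl, Matrix.sub_mul, Matrix.one_mul, Matrix.smul_mul, Matrix.sub_apply,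
      Matrix.smul_apply, smul_eq_mul, Matrix.vecMulVec_mul, Matrix.vecMulVec_apply,
      ← Matrix.mulVec_transpose]
  have h1 : ∑ i, ∑ j, B i j * (y i * z j) = z ⬝ᵥ z := by
    rw [Finset.sum_comm]
    refine Finset.sum_congr rfl fun j _ => ?_
    have hzj : z j = ∑ i, B i j * y i := rfl
    nth_rewrite 2 [hzj]
    rw [Finset.sum_mul]
    exact Finset.sum_congr rfl fun i _ => by ring
  have h2 : ∑ i, ∑ j, (y i * z j) ^ 2 = (y ⬝ᵥ y) * (z ⬝ᵥ z) := by
    rw [dotProduct, dotProduct, Finset.sum_mul_sum]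
    exact Finset.sum_congr rfl fun i _ => Finset.sum_congr rfl fun j _ => by ring
  have h3 : frobSq (projCompl y * B) =
      frobSq B - 2 * c * (∑ i, ∑ j, B i j * (y i * z j)) +
        c ^ 2 * ∑ i, ∑ j, (y i * z j) ^ 2 := by
    simp only [frobSq, hent, Finset.mul_sum, ← Finset.sum_sub_distrib, ← Finset.sum_add_distrib]
    exact Finset.sum_congr rfl fun i _ => Finset.sum_congr rfl fun j _ => by ring
  rw [h3, h1, h2, div_eq_mul_inv, ← hc]
  linear_combination (z ⬝ᵥ z) * inv_mul_sq_mul (y ⬝ᵥ y)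

theorem frobSq_projCompl_mul_le (y : Fin n → ℝ) (B : Matrix (Fin n) (Fin n) ℝ) :
    frobSq (projCompl y * B) ≤ frobSq B := by
  rw [frobSq_projCompl_mul, sub_le_self_iff]
  exact div_nonneg (Finset.sum_nonneg fun i _ => mul_self_nonneg _)
    (Finset.sum_nonneg fun i _ => mul_self_nonneg _)

/-- Projecting away the image of a random sign vector decreases the Frobenius norm with constant
probability. -/
theorem exists_good_signs {p : ℝ} (hp : 1 ≤ p) (hp2 : p < 2) {B : Matrix (Fin n) (Fin n) ℝ}
    (h : ∑ k, sv B k ^ p ≤ 1) (hB : 0 < frobSq B) :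
    ∃ w : (Fin n → Bool) → ℝ, (∀ g, w g = 0 ∨ w g = 1) ∧ 1 / 24 ≤ 𝔼 g, w g ∧
      ∀ g, w g = 1 → frobSq (projCompl (B *ᵥ signVec g) * B) ≤
        frobSq B - frobSq B ^ (1 + p / (2 - p)) / 48 := by
  classical
  set M := Bᵀ * B with hM
  have hint := frobSq_rpow_le_frobSq_gram hp hp2 h
  rw [← hM] at hint
  have hMpos : 0 < frobSq M := (Real.rpow_pos_of_pos hB _).trans_le hint
  -- `P` makes the numerator of the decrease large (probability at least 1/12), and `Q` makes its
  -- denominator large (probability at most 1/24, by Markov). On `P` without `Q` the decrease is at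
  -- least F(M)/(48 F(B)).
  set P : (Fin n → Bool) → Prop := fun g => frobSq M / 2 ≤ M *ᵥ signVec g ⬝ᵥ M *ᵥ signVec g
  set Q : (Fin n → Bool) → Prop := fun g => 24 * frobSq B < B *ᵥ signVec g ⬝ᵥ B *ᵥ signVec g
  refine ⟨fun g => if P g ∧ ¬ Q g then 1 else 0, fun g => ?_, ?_, fun g hg => ?_⟩
  · dsimp only; split_ifs <;> simp
  · have h1 : 1 / 12 ≤ 𝔼 g, (if P g then (1 : ℝ) else 0) :=
      one_twelfth_le_expect _ hMpos (expect_normSq M) (expect_normSq_sq_le M)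
    have h2 : 𝔼 g, (if Q g then (1 : ℝ) else 0) ≤ 1 / 24 := by
      refine (expect_ite_lt_le (fun g => B *ᵥ signVec g ⬝ᵥ B *ᵥ signVec g)
        (by positivity : 0 < 24 * frobSq B)
        (fun g => Finset.sum_nonneg fun i _ => mul_self_nonneg _)).trans ?_
      rw [expect_normSq]
      exact le_of_eq (by field_simp)
    have h3 : 𝔼 g, ((if P g then (1 : ℝ) else 0) - (if Q g then (1 : ℝ) else 0)) ≤
        𝔼 g, (if P g ∧ ¬ Q g then (1 : ℝ) else 0) :=
      expect_le_expect fun g _ => by split_ifs <;> simp_all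
    rw [expect_sub_distrib] at h3
    linarith
  · have hg' : P g ∧ ¬ Q g := by
      by_contra hcon
      simp [hcon] at hg
    obtain ⟨hP, hQ⟩ := hg'
    rw [frobSq_projCompl_mul, Matrix.mulVec_mulVec, ← hM]
    simp only [P, Q, not_lt] at hP hQ
    have hy : 0 < B *ᵥ signVec g ⬝ᵥ B *ᵥ signVec g := by
      refine lt_of_le_of_ne (Finset.sum_nonneg fun i _ => mul_self_nonneg _) fun h0 => ?_
      have h1 : B *ᵥ signVec g = 0 := dotProduct_self_eq_zero.mp h0.symm
      have h2 : M *ᵥ signVec g = 0 := by rw [hM, ← Matrix.mulVec_mulVec, h1, Matrix.mulVec_zero]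
      rw [h2, dotProduct_zero] at hP
      linarith
    refine sub_le_sub_left ?_ _
    rw [le_div_iff₀ hy]
    have h4 : frobSq B ^ (2 + p / (2 - p)) = frobSq B * frobSq B ^ (1 + p / (2 - p)) := by
      rw [← Real.rpow_one_add' hB.le]
      · ring_nf
      · have : 0 ≤ p / (2 - p) := div_nonneg (by linarith) (by linarith)
        linarith
    have h5 : 0 ≤ frobSq B ^ (1 + p / (2 - p)) := Real.rpow_nonneg hB.le _
    nlinarith [mul_le_mul_of_nonneg_left hQ h5]

end RandomSigns
-- Independent copies and majority amplification.
section Averages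

open Matrix Finset
open scoped BigOperators

theorem expect_fin_cons {X : Type*} [Fintype X] (N : ℕ) (f : (Fin (N + 1) → X) → ℝ) :
    𝔼 ω, f ω = 𝔼 x, 𝔼 ω : Fin N → X, f (Fin.cons x ω) := by
  rw [Fintype.expect_equiv (Fin.consEquiv fun _ => X).symm f
    (fun q => f (Fin.cons q.1 q.2)) (fun ω => by simp [Fin.consEquiv]),
    ← univ_product_univ, expect_product]

theorem expect_sum_sq {X : Type*} [Fintype X] [Nonempty X] {h : X → ℝ} (h0 : 𝔼 x, h x = 0) :
    ∀ s : ℕ, 𝔼 ω : Fin s → X, (∑ k, h (ω k)) ^ 2 = s * 𝔼 x, h x ^ 2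
  | 0 => by simp
  | s + 1 => by
    rw [expect_fin_cons]
    simp only [Fin.sum_univ_succ, Fin.cons_zero, Fin.cons_succ]
    have : ∀ x, 𝔼 ω : Fin s → X, (h x + ∑ k, h (ω k)) ^ 2 =
        h x ^ 2 + 2 * (𝔼 ω : Fin s → X, ∑ k, h (ω k)) * h x +
          𝔼 ω : Fin s → X, (∑ k, h (ω k)) ^ 2 := fun x => by
      simp only [add_sq, expect_add_distrib, Fintype.expect_const, ← mul_expect]
      ring
    simp only [this, expect_add_distrib, Fintype.expect_const, ← mul_expect, h0,
      expect_sum_sq h0 s]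
    push_cast
    ring

/-- If an event has probability at most `1 / 16`, then among `R` independent copies at least half
occur with probability at most `(19 / 32) ^ R`. -/
theorem expect_majority_bad_le {Y : Type*} [Fintype Y] [Nonempty Y] (bad : Y → Prop)
    [DecidablePred bad] (h : 𝔼 y, (if bad y then (1 : ℝ) else 0) ≤ 1 / 16) (R : ℕ) :
    𝔼 ω : Fin R → Y, (if R ≤ 2 * #{j | bad (ω j)} then (1 : ℝ) else 0) ≤ (19 / 32) ^ R := by
  set f : Y → ℝ := fun y => if bad y then 4 else 1 with hf
  have hfE : 𝔼 y, f y ≤ 19 / 16 := by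
    have : ∀ y, f y = 1 + 3 * (if bad y then (1 : ℝ) else 0) := fun y => by
      simp only [hf]; split_ifs <;> norm_num
    simp only [this, expect_add_distrib, Fintype.expect_const, ← mul_expect]
    linarith
  -- Chernoff's method with base 4: at least R/2 bad copies force this product to be at least 2^R,
  -- while its mean is at most (19/16)^R.
  have hpow : ∀ ω : Fin R → Y, ∏ j, f (ω j) = 4 ^ #{j | bad (ω j)} := fun ω => by
    simp only [hf, Finset.prod_ite, Finset.prod_const, one_pow, mul_one]
  calc 𝔼 ω : Fin R → Y, (if R ≤ 2 * #{j | bad (ω j)} then (1 : ℝ) else 0)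
      ≤ 𝔼 ω : Fin R → Y, (∏ j, f (ω j)) / 2 ^ R := by
        refine expect_le_expect fun ω _ => ?_
        rw [hpow]
        split_ifs with hc
        · rw [one_le_div (by positivity), show (4 : ℝ) = 2 ^ 2 by norm_num, ← pow_mul]
          exact pow_le_pow_right₀ (by norm_num) hc
        · positivity
    _ = (𝔼 y, f y) ^ R / 2 ^ R := by
        rw [← expect_div, expect_pow, Fintype.piFinset_univ]
    _ ≤ (19 / 32) ^ R := by
        rw [← div_pow]
        refine pow_le_pow_left₀ (div_nonneg (expect_nonneg fun y _ => ?_) (by norm_num)) ?_ R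
        · simp only [hf]; split_ifs <;> norm_num
        · linarith

/-- A point within `η / 2` of a strict majority of the numbers `a j`, if there is one. -/
noncomputable def majorityPoint {R : ℕ} (a : Fin R → ℝ) (η : ℝ) : ℝ :=
  open Classical in
  if h : ∃ t, R < 2 * #{j | |a j - t| ≤ η / 2} then h.choose else 0

/-- Two strict majorities share an index `j`, and `a j` is within `η / 2` of both points. -/
theorem abs_majorityPoint_sub_le {R : ℕ} (a : Fin R → ℝ) {η τ : ℝ}
    (h : R < 2 * #{j | |a j - τ| ≤ η / 2}) : |majorityPoint a η - τ| ≤ η := by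
  classical
  have hex : ∃ t, R < 2 * #{j | |a j - t| ≤ η / 2} := ⟨τ, by convert! h⟩
  have hm : majorityPoint a η = hex.choose := by
    rw [majorityPoint, dif_pos]
  have hc := hex.choose_spec
  rw [← hm] at hc
  set t := majorityPoint a η
  obtain ⟨j, hj⟩ : (({j | |a j - t| ≤ η / 2} : Finset (Fin R)) ∩
      ({j | |a j - τ| ≤ η / 2} : Finset (Fin R))).Nonempty := by
    rw [← Finset.card_pos]
    have h1 := Finset.card_union_add_card_inter ({j | |a j - t| ≤ η / 2} : Finset (Fin R))
      {j | |a j - τ| ≤ η / 2}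
    have h2 := Finset.card_le_univ (({j | |a j - t| ≤ η / 2} : Finset (Fin R)) ∪
      ({j | |a j - τ| ≤ η / 2} : Finset (Fin R)))
    rw [Fintype.card_fin] at h2
    have h' : R < 2 * #({j | |a j - τ| ≤ η / 2} : Finset (Fin R)) := by convert! h
    omega
  simp only [Finset.mem_inter, Finset.mem_filter, Finset.mem_univ, true_and, abs_le] at hj
  rw [abs_le]
  constructor <;> linarith [hj.1.1, hj.1.2, hj.2.1, hj.2.2]

end Averages

/-! ### Convergence of the range finder; concentration of the trace estimate. -/

section RangeFinder

open Matrix Finset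
open scoped BigOperators

variable {n : ℕ}

/-- A function of the squared Frobenius norm that decreases geometrically in expectation. -/
noncomputable def potential (r F : ℝ) : ℝ := if F = 0 then 0 else Real.exp (-(48 / F ^ r))

theorem potential_nonneg (r F : ℝ) : 0 ≤ potential r F := by
  unfold potential; split_ifs <;> positivity

theorem potential_le_one {r F : ℝ} (hF : 0 ≤ F) : potential r F ≤ 1 := by
  unfold potential
  split_ifs
  · norm_num
  · rw [Real.exp_le_one_iff, neg_nonpos]
    have := Real.rpow_nonneg hF r
    positivity

theorem potential_mono {r F G : ℝ} (hr : 0 ≤ r) (hF : 0 ≤ F) (hFG : F ≤ G) :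
    potential r F ≤ potential r G := by
  rcases hF.eq_or_lt with rfl | hF
  · simpa [potential] using potential_nonneg r G
  have hG := hF.trans_le hFG
  rw [potential, potential, if_neg hF.ne', if_neg hG.ne', Real.exp_le_exp, neg_le_neg_iff]
  exact div_le_div_of_nonneg_left (by norm_num) (Real.rpow_pos_of_pos hF r)
    (Real.rpow_le_rpow hF.le hFG hr)

/-- The decrease of F raises 48/Fʳ by at least 1, and e⁻¹ ≤ 1/2. The case `F = 0` is covered by the
definition of `potential`; there the exponential formula would give 1, through division by zero. -/
theorem potential_step {r F G : ℝ} (hr : 1 ≤ r) (hF : 0 ≤ F) (hG : 0 < G) (hG1 : G ≤ 1)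
    (h : F ≤ G - G ^ (1 + r) / 48) : potential r F ≤ potential r G / 2 := by
  rcases hF.eq_or_lt with rfl | hF
  · have := potential_nonneg r G
    simp only [potential, if_true] at this ⊢
    linarith
  set x := G ^ r with hx
  have hx0 : 0 < x := Real.rpow_pos_of_pos hG r
  have hx1 : x ≤ 1 := Real.rpow_le_one hG.le hG1 (by linarith)
  have h1 : F ≤ G * (1 - x / 48) := by
    rw [Real.rpow_add hG, Real.rpow_one] at h
    linarith
  have h2 : F ^ r ≤ x * (1 - x / 48) := by
    have ha : 0 < 1 - x / 48 := by linarith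
    calc F ^ r ≤ (G * (1 - x / 48)) ^ r := Real.rpow_le_rpow hF.le h1 (by linarith)
      _ = x * (1 - x / 48) ^ r := Real.mul_rpow hG.le ha.le
      _ ≤ x * (1 - x / 48) ^ (1 : ℝ) := mul_le_mul_of_nonneg_left
          (Real.rpow_le_rpow_of_exponent_ge ha (by linarith) hr) hx0.le
      _ = x * (1 - x / 48) := by rw [Real.rpow_one]
  have h3 : 48 / x + 1 ≤ 48 / F ^ r := by
    rw [le_div_iff₀ (Real.rpow_pos_of_pos hF r)]
    calc (48 / x + 1) * F ^ r ≤ (48 / x + 1) * (x * (1 - x / 48)) :=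
          mul_le_mul_of_nonneg_left h2 (by positivity)
      _ = 48 - x ^ 2 / 48 := by field_simp; ring
      _ ≤ 48 := by linarith [sq_nonneg x]
  rw [potential, potential, if_neg hF.ne', if_neg hG.ne', ← hx]
  calc Real.exp (-(48 / F ^ r)) ≤ Real.exp (-(48 / x) + -1) :=
        Real.exp_le_exp.mpr (by linarith)
    _ = Real.exp (-(48 / x)) * Real.exp (-1) := Real.exp_add _ _
    _ ≤ Real.exp (-(48 / x)) * (1 / 2) := by
        refine mul_le_mul_of_nonneg_left ?_ (Real.exp_pos _).le
        rw [Real.exp_neg, one_div]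
        exact inv_anti₀ (by norm_num) (by linarith [Real.add_one_le_exp (1 : ℝ)])
    _ = _ := by ring

/-- The projection obtained from `E` by successively projecting away `E' (B g)`, where `g` runs
through random sign vectors and `E'` is the current projection. -/
noncomputable def rangeResidual (B : Matrix (Fin n) (Fin n) ℝ) :
    (N : ℕ) → (Fin N → Fin n → Bool) → Matrix (Fin n) (Fin n) ℝ → Matrix (Fin n) (Fin n) ℝ
  | 0, _, E => E
  | N + 1, ω, E =>
    rangeResidual B N (Fin.tail ω) (projCompl (E *ᵥ (B *ᵥ signVec (ω 0))) * E)

theorem isContr_rangeResidual (B : Matrix (Fin n) (Fin n) ℝ) :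
    ∀ (N : ℕ) (ω : Fin N → Fin n → Bool) (E : Matrix (Fin n) (Fin n) ℝ), IsContr E →
      IsContr (rangeResidual B N ω E)
  | 0, _, _, hE => hE
  | N + 1, _, _, hE => isContr_rangeResidual B N _ _ ((isContr_projCompl _).mul hE)

theorem expect_potential_step {p : ℝ} (hp : 1 ≤ p) (hp2 : p < 2)
    {B : Matrix (Fin n) (Fin n) ℝ} (h : ∑ k, sv B k ^ p ≤ 1) :
    𝔼 g, potential (p / (2 - p)) (frobSq (projCompl (B *ᵥ signVec g) * B)) ≤
      47 / 48 * potential (p / (2 - p)) (frobSq B) := by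
  have hr : 1 ≤ p / (2 - p) := by rw [le_div_iff₀] <;> linarith
  set r := p / (2 - p)
  rcases (frobSq_nonneg B).eq_or_lt with h0 | h0
  · have : ∀ g, frobSq (projCompl (B *ᵥ signVec g) * B) = 0 := fun g =>
      le_antisymm ((frobSq_projCompl_mul_le _ _).trans h0.symm.le) (frobSq_nonneg _)
    simp [this, ← h0, potential]
  obtain ⟨w, hw01, hwE, hw⟩ := exists_good_signs hp hp2 h h0
  -- The potential never increases and halves with probability at least 1/24, whence 47/48 = 1 -
  -- 1/48.
  have hpt : ∀ g, potential r (frobSq (projCompl (B *ᵥ signVec g) * B)) ≤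
      potential r (frobSq B) + -(potential r (frobSq B) / 2) * w g := by
    intro g
    rcases hw01 g with h1 | h1
    · rw [h1, mul_zero, add_zero]
      exact potential_mono (by linarith) (frobSq_nonneg _) (frobSq_projCompl_mul_le _ _)
    · have := potential_step hr (frobSq_nonneg _) h0 (frobSq_le_one hp hp2.le h) (hw g h1)
      rw [h1]
      linarith
  refine (expect_le_expect fun g _ => hpt g).trans ?_
  rw [expect_add_distrib, Fintype.expect_const, ← mul_expect]
  nlinarith [potential_nonneg r (frobSq B)]

theorem expect_potential_residual_le {p : ℝ} (hp : 1 ≤ p) (hp2 : p < 2)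
    {B : Matrix (Fin n) (Fin n) ℝ} (h : ∑ k, sv B k ^ p ≤ 1) :
    ∀ (N : ℕ) (E : Matrix (Fin n) (Fin n) ℝ), IsContr E →
      𝔼 ω, potential (p / (2 - p)) (frobSq (rangeResidual B N ω E * B)) ≤
        (47 / 48) ^ N * potential (p / (2 - p)) (frobSq (E * B))
  | 0, E, _ => by simp [rangeResidual]
  | N + 1, E, hE => by
    rw [expect_fin_cons]
    simp only [rangeResidual, Fin.cons_zero, Fin.tail_cons]
    refine (expect_le_expect fun g _ => expect_potential_residual_le hp hp2 h N _
      ((isContr_projCompl _).mul hE)).trans ?_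
    rw [← mul_expect, pow_succ, mul_assoc]
    refine mul_le_mul_of_nonneg_left ?_ (by positivity)
    simp only [Matrix.mul_assoc, Matrix.mulVec_mulVec]
    exact expect_potential_step hp hp2 ((sum_sv_rpow_contr_mul_le hp hE B).trans h)

/-- The range finder: after `N` steps the residual has a small Frobenius norm, with a failure
probability that is exponentially small in `N`. -/
theorem expect_frobSq_residual_large_le {p : ℝ} (hp : 1 ≤ p) (hp2 : p ≤ 2)
    {B : Matrix (Fin n) (Fin n) ℝ} (h : ∑ k, sv B k ^ p ≤ 1) {N : ℕ} (hN : 0 < N) :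
    𝔼 ω, (if (4608 / N : ℝ) ^ ((2 - p) / p) < frobSq (rangeResidual B N ω 1 * B) then (1 : ℝ) else 0)
      ≤ Real.exp (-(N / 96)) := by
  -- At p = 2 the exponent p/(2-p) is unavailable, but the threshold is 1 and the bound is trivial.
  rcases hp2.eq_or_lt with rfl | hp2
  · have : ∀ ω, ¬ ((4608 / N : ℝ) ^ (((2 : ℝ) - 2) / 2) < frobSq (rangeResidual B N ω 1 * B)) := by
      intro ω
      rw [sub_self, zero_div, Real.rpow_zero, not_lt]
      exact frobSq_le_one hp le_rfl
        ((sum_sv_rpow_contr_mul_le hp (isContr_rangeResidual B N ω 1 isContr_one) B).trans h)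
    simp only [this, if_false, expect_const_zero]
    positivity
  have hr : 0 < p / (2 - p) := div_pos (by linarith) (by linarith)
  set r := p / (2 - p) with hrdef
  have hN' : (0 : ℝ) < N := by exact_mod_cast hN
  set θ := (4608 / N : ℝ) ^ ((2 - p) / p) with hθ
  have hθ0 : 0 < θ := Real.rpow_pos_of_pos (by positivity) _
  have hθr : θ ^ r = 4608 / N := by
    rw [hθ, ← Real.rpow_mul (by positivity), hrdef, div_mul_div_cancel₀ (by linarith), div_self
      (by linarith), Real.rpow_one]
  -- 4608 = 48 · 96: the threshold spends half of the decay exp(-N/48), and Markov's inequality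
  -- leaves the other half.
  have hpθ : potential r θ = Real.exp (-(N / 96)) := by
    rw [potential, if_neg hθ0.ne', hθr]
    congr 2
    field_simp
    norm_num
  have hpos : 0 < potential r θ := hpθ ▸ Real.exp_pos _
  calc 𝔼 ω, (if θ < frobSq (rangeResidual B N ω 1 * B) then (1 : ℝ) else 0)
      ≤ 𝔼 ω, potential r (frobSq (rangeResidual B N ω 1 * B)) / potential r θ := by
        refine expect_le_expect fun ω _ => ?_
        split_ifs with hc
        · rw [one_le_div hpos]
          exact potential_mono hr.le hθ0.le hc.le
        · exact div_nonneg (potential_nonneg _ _) hpos.le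
    _ ≤ (47 / 48) ^ N / potential r θ := by
        rw [← expect_div]
        exact div_le_div_of_nonneg_right
          ((expect_potential_residual_le hp hp2 h N 1 isContr_one).trans
            (mul_le_of_le_one_right (by positivity) (potential_le_one (frobSq_nonneg _)))) hpos.le
    _ ≤ Real.exp (-(N / 48)) / Real.exp (-(N / 96)) := by
        rw [hpθ]
        refine div_le_div_of_nonneg_right ?_ (Real.exp_pos _).le
        calc ((47 : ℝ) / 48) ^ N ≤ (Real.exp (-(1 / 48))) ^ N :=
              pow_le_pow_left₀ (by norm_num) (by linarith [Real.add_one_le_exp (-(1 / 48) : ℝ)]) N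
          _ = Real.exp (-(N / 48)) := by
              rw [← Real.exp_nat_mul]
              congr 1
              ring
    _ = Real.exp (-(N / 96)) := by
        rw [← Real.exp_sub]
        congr 1
        ring

/-- Concentration of the median-of-means version of the Hutchinson estimator. -/
theorem expect_medianOfMeans_bad_le (D : Matrix (Fin n) (Fin n) ℝ) {η : ℝ} (hη : 0 < η)
    {s : ℕ} (hs : 0 < s) (hD : 128 * frobSq D ≤ s * η ^ 2) (R : ℕ) :
    𝔼 ω : Fin R → Fin s → Fin n → Bool,
      (if |majorityPoint (fun j => (∑ k, signVec (ω j k) ⬝ᵥ D *ᵥ signVec (ω j k)) / s) η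
        - D.trace| ≤ η then (0 : ℝ) else 1) ≤ (19 / 32) ^ R := by
  classical
  have hs' : (0 : ℝ) < s := by exact_mod_cast hs
  set h : (Fin n → Bool) → ℝ := fun g => signVec g ⬝ᵥ D *ᵥ signVec g - D.trace with hh
  have hmean : ∀ v : Fin s → Fin n → Bool,
      (∑ k, signVec (v k) ⬝ᵥ D *ᵥ signVec (v k)) / s - D.trace = (∑ k, h (v k)) / s := by
    intro v
    simp only [hh, Finset.sum_sub_distrib, Finset.sum_const, Finset.card_univ, Fintype.card_fin,
      nsmul_eq_mul]
    field_simp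
  have hbad : 𝔼 v : Fin s → Fin n → Bool,
      (if ¬ |(∑ k, signVec (v k) ⬝ᵥ D *ᵥ signVec (v k)) / s - D.trace| ≤ η / 2 then (1 : ℝ)
        else 0) ≤ 1 / 16 := by
    -- Chebyshev: a mean of `s` estimates misses by more than η/2 with probability at most
    -- 8F(D)/(sη²) ≤ 1/16.
    have hc : 0 < (s * η / 2) ^ 2 := by positivity
    calc _ = 𝔼 v : Fin s → Fin n → Bool,
          (if (s * η / 2) ^ 2 < (∑ k, h (v k)) ^ 2 then (1 : ℝ) else 0) := by
          refine expect_congr rfl fun v _ => if_congr ?_ rfl rfl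
          rw [hmean, not_le, abs_div, abs_of_pos hs', lt_div_iff₀ hs', sq_lt_sq,
            abs_of_pos (by positivity : 0 < s * η / 2)]
          ring_nf
      _ ≤ (𝔼 v : Fin s → Fin n → Bool, (∑ k, h (v k)) ^ 2) / (s * η / 2) ^ 2 :=
          expect_ite_lt_le (fun v : Fin s → Fin n → Bool => (∑ k, h (v k)) ^ 2) hc
            fun v => sq_nonneg _
      _ ≤ 1 / 16 := by
          rw [expect_sum_sq (expect_quadForm_sub_trace D), div_le_iff₀ hc]
          have h1 := expect_quadForm_sub_trace_sq_le D
          calc s * 𝔼 g, h g ^ 2 ≤ s * (2 * frobSq D) :=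
                mul_le_mul_of_nonneg_left h1 hs'.le
            _ = s * (128 * frobSq D) / 64 := by ring
            _ ≤ s * (s * η ^ 2) / 64 := by
                have := mul_le_mul_of_nonneg_left hD hs'.le
                linarith
            _ = 1 / 16 * (s * η / 2) ^ 2 := by ring
  refine le_trans (expect_le_expect fun ω _ => ?_) (expect_majority_bad_le _ hbad R)
  split_ifs with h1 h2 h2
  · norm_num
  · norm_num
  · exact le_rfl
  · exfalso
    apply h1
    apply abs_majorityPoint_sub_le
    have := Finset.card_filter_add_card_filter_not (s := (univ : Finset (Fin R)))
      (fun j => |(∑ k, signVec (ω j k) ⬝ᵥ D *ᵥ signVec (ω j k)) / s - D.trace| ≤ η / 2)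
    rw [Finset.card_univ, Fintype.card_fin] at this
    omega

end RangeFinder
-- The estimator for one matrix as a query program, and its cost.
section Programs

open Matrix Finset
open scoped BigOperators

namespace QueryProgram

variable {n : ℕ} {ι β γ : Type}

/-- Sequential composition of programs. -/
def bind : QueryProgram n ι β → (β → QueryProgram n ι γ) → QueryProgram n ι γ
  | ret b, f => f b
  | query j x next, f => query j x fun a => bind (next a) f

theorem result_bind (A : ι → Matrix (Fin n) (Fin n) ℝ) (f : β → QueryProgram n ι γ) :
    ∀ P : QueryProgram n ι β, (P.bind f).result A = (f (P.result A)).result A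
  | ret _ => rfl
  | query _ _ next => result_bind A f (next _)

theorem cost_bind (A : ι → Matrix (Fin n) (Fin n) ℝ) (f : β → QueryProgram n ι γ) :
    ∀ P : QueryProgram n ι β, (P.bind f).cost A = P.cost A + (f (P.result A)).cost A
  | ret _ => (Nat.zero_add _).symm
  | query _ _ next => by
    simp only [bind, cost, result, cost_bind A f (next _)]
    ring

/-- Run a program on a single matrix, answering its queries by the program `q`. -/
def simulate (q : (Fin n → ℝ) → QueryProgram n ι (Fin n → ℝ)) :
    QueryProgram n Unit β → QueryProgram n ι β
  | ret b => ret b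
  | query _ x next => (q x).bind fun a => simulate q (next a)

theorem result_simulate (A : ι → Matrix (Fin n) (Fin n) ℝ)
    (q : (Fin n → ℝ) → QueryProgram n ι (Fin n → ℝ)) (B : Matrix (Fin n) (Fin n) ℝ)
    (hq : ∀ x, (q x).result A = B *ᵥ x) :
    ∀ P : QueryProgram n Unit β, (P.simulate q).result A = P.result fun _ => B
  | ret _ => rfl
  | query _ x next => by
    rw [simulate, result_bind, hq, result_simulate A q B hq (next _)]
    rfl

theorem cost_simulate_le (A : ι → Matrix (Fin n) (Fin n) ℝ)
    (q : (Fin n → ℝ) → QueryProgram n ι (Fin n → ℝ)) (B : Matrix (Fin n) (Fin n) ℝ)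
    (hq : ∀ x, (q x).result A = B *ᵥ x) (c : ℕ) (hc : ∀ x, (q x).cost A ≤ c) :
    ∀ P : QueryProgram n Unit β, (P.simulate q).cost A ≤ c * P.cost fun _ => B
  | ret _ => Nat.zero_le _
  | query _ x next => by
    rw [simulate, cost_bind, hq, cost, mul_add, mul_one, add_comm]
    exact add_le_add (cost_simulate_le A q B hq c hc (next _)) (hc x)

end QueryProgram

open QueryProgram

variable {n : ℕ}

/-- Query all vectors of a given family. -/
def collect : (M : ℕ) → (Fin M → Fin n → ℝ) → QueryProgram n Unit (Fin M → Fin n → ℝ)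
  | 0, _ => ret Fin.elim0
  | M + 1, x => query () (x 0) fun a => (collect M (Fin.tail x)).bind fun b => ret (Fin.cons a b)

theorem result_collect (B : Matrix (Fin n) (Fin n) ℝ) :
    ∀ (M : ℕ) (x : Fin M → Fin n → ℝ),
      (collect M x).result (fun _ => B) = fun i => B *ᵥ x i
  | 0, _ => funext fun i => i.elim0
  | M + 1, x => by
    funext i
    simp only [collect, result, result_bind, result_collect B M]
    refine Fin.cases ?_ (fun j => ?_) i
    · simp
    · simp [Fin.tail]

theorem cost_collect (B : Matrix (Fin n) (Fin n) ℝ) :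
    ∀ (M : ℕ) (x : Fin M → Fin n → ℝ), (collect M x).cost (fun _ => B) = M
  | 0, _ => rfl
  | M + 1, x => by simp [collect, cost, cost_bind, cost_collect B M]

/-- The range finder as a program. It maintains a contraction `E` and a number `c` such that
`tr B = c + tr (E B)`. -/
noncomputable def rangeProgram : (N : ℕ) → (Fin N → Fin n → Bool) → Matrix (Fin n) (Fin n) ℝ → ℝ →
    QueryProgram n Unit (Matrix (Fin n) (Fin n) ℝ × ℝ)
  | 0, _, E, c => ret (E, c)
  | N + 1, ω, E, c =>
    -- The first answer gives the direction y = E(Bg); the second, b = By, gives the trace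
    -- y·EBy/(y·y) that projecting away y removes from EB.
    query () (signVec (ω 0)) fun a => query () (E *ᵥ a) fun b =>
      rangeProgram N (Fin.tail ω) (projCompl (E *ᵥ a) * E)
        (c + (E *ᵥ a ⬝ᵥ E *ᵥ a)⁻¹ * (E *ᵥ a ⬝ᵥ E *ᵥ b))

theorem trace_projCompl_mul (y : Fin n → ℝ) (B : Matrix (Fin n) (Fin n) ℝ) :
    (projCompl y * B).trace = B.trace - (y ⬝ᵥ y)⁻¹ * (y ⬝ᵥ B *ᵥ y) := by
  rw [projCompl, Matrix.sub_mul, Matrix.one_mul, Matrix.smul_mul, Matrix.trace_sub,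
    Matrix.trace_smul, smul_eq_mul, Matrix.vecMulVec_mul, Matrix.trace_vecMulVec,
    Matrix.dotProduct_mulVec, dotProduct_comm y (y ᵥ* B)]

theorem result_rangeProgram (B : Matrix (Fin n) (Fin n) ℝ) :
    ∀ (N : ℕ) (ω : Fin N → Fin n → Bool) (E : Matrix (Fin n) (Fin n) ℝ) (c : ℝ),
      (rangeProgram N ω E c).result (fun _ => B) =
        (rangeResidual B N ω E, c + (E * B).trace - (rangeResidual B N ω E * B).trace)
  | 0, _, E, c => by simp [rangeProgram, result, rangeResidual]
  | N + 1, ω, E, c => by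
    rw [rangeProgram, result, result, result_rangeProgram B N, rangeResidual, Matrix.mul_assoc,
      trace_projCompl_mul, ← Matrix.mulVec_mulVec]
    congr 1
    ring

theorem cost_rangeProgram (B : Matrix (Fin n) (Fin n) ℝ) :
    ∀ (N : ℕ) (ω : Fin N → Fin n → Bool) (E : Matrix (Fin n) (Fin n) ℝ) (c : ℝ),
      (rangeProgram N ω E c).cost (fun _ => B) = 2 * N
  | 0, _, _, _ => rfl
  | N + 1, ω, E, c => by
    rw [rangeProgram, cost, cost, cost_rangeProgram B N]
    ring

/-- The trace estimator: a range finder with `R * s` steps, followed by a median of `R` means of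
`s` Hutchinson estimates of the trace of the residual. -/
noncomputable def traceProgram (R s : ℕ) (η : ℝ)
    (ω : (Fin (R * s) → Fin n → Bool) × (Fin R → Fin s → Fin n → Bool)) : QueryProgram n Unit ℝ :=
  (rangeProgram (R * s) ω.1 1 0).bind fun Ec =>
    (collect (R * s) fun i =>
      signVec (ω.2 (finProdFinEquiv.symm i).1 (finProdFinEquiv.symm i).2)).bind fun a =>
        ret (Ec.2 + majorityPoint
          (fun j => (∑ k, signVec (ω.2 j k) ⬝ᵥ Ec.1 *ᵥ a (finProdFinEquiv (j, k))) / s) η)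

theorem result_traceProgram (R s : ℕ) (η : ℝ)
    (ω : (Fin (R * s) → Fin n → Bool) × (Fin R → Fin s → Fin n → Bool))
    (B : Matrix (Fin n) (Fin n) ℝ) :
    (traceProgram R s η ω).result (fun _ => B) - B.trace =
      majorityPoint (fun j => (∑ k, signVec (ω.2 j k) ⬝ᵥ
        (rangeResidual B (R * s) ω.1 1 * B) *ᵥ signVec (ω.2 j k)) / s) η -
        (rangeResidual B (R * s) ω.1 1 * B).trace := by
  simp only [traceProgram, result_bind, result_rangeProgram, result_collect, result,
    Equiv.symm_apply_apply, Matrix.one_mul, zero_add, Matrix.mulVec_mulVec]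
  ring

theorem cost_traceProgram (R s : ℕ) (η : ℝ)
    (ω : (Fin (R * s) → Fin n → Bool) × (Fin R → Fin s → Fin n → Bool))
    (B : Matrix (Fin n) (Fin n) ℝ) :
    (traceProgram R s η ω).cost (fun _ => B) = 3 * (R * s) := by
  simp only [traceProgram, cost_bind, cost_rangeProgram, cost_collect, cost]
  ring

theorem expect_traceProgram_bad_le {p : ℝ} (hp : 1 ≤ p) (hp2 : p ≤ 2) {R s : ℕ} (hR : 0 < R)
    (hs : 0 < s) {η : ℝ} (hη : 0 < η)
    (hθ : 128 * (4608 / (R * s : ℕ) : ℝ) ^ ((2 - p) / p) ≤ s * η ^ 2)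
    {B : Matrix (Fin n) (Fin n) ℝ} (h : ∑ k, sv B k ^ p ≤ 1) :
    𝔼 ω, (if |(traceProgram R s η ω).result (fun _ => B) - B.trace| ≤ η then (0 : ℝ) else 1) ≤
      2 * Real.exp (-(R / 96)) := by
  set N := R * s with hN
  set θ := (4608 / (N : ℕ) : ℝ) ^ ((2 - p) / p)
  simp only [result_traceProgram]
  rw [← univ_product_univ, expect_product]
  simp only
  -- The Hutchinson signs are independent of the range finder, so the residual is fixed while they
  -- are averaged.
  have h1 : ∀ ω₁ : Fin N → Fin n → Bool, 𝔼 ω₂ : Fin R → Fin s → Fin n → Bool,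
      (if |majorityPoint (fun j => (∑ k, signVec (ω₂ j k) ⬝ᵥ
        (rangeResidual B N ω₁ 1 * B) *ᵥ signVec (ω₂ j k)) / s) η -
        (rangeResidual B N ω₁ 1 * B).trace| ≤ η then (0 : ℝ) else 1) ≤
      (if θ < frobSq (rangeResidual B N ω₁ 1 * B) then (1 : ℝ) else 0) + (19 / 32) ^ R := by
    intro ω₁
    split_ifs with hc
    · refine le_trans (expect_le_expect (g := fun _ => (1 : ℝ)) fun ω₂ _ => ?_) ?_
      · split_ifs <;> norm_num
      · rw [Fintype.expect_const]
        exact le_add_of_nonneg_right (by positivity)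
    · rw [zero_add]
      exact expect_medianOfMeans_bad_le _ hη hs (by linarith [not_lt.mp hc]) R
  refine (expect_le_expect fun ω₁ _ => h1 ω₁).trans ?_
  rw [expect_add_distrib, Fintype.expect_const]
  have h2 := expect_frobSq_residual_large_le hp hp2 h (Nat.mul_pos hR hs)
  have h3 : Real.exp (-((N : ℕ) / 96)) ≤ Real.exp (-(R / 96)) := by
    rw [Real.exp_le_exp, neg_le_neg_iff]
    refine div_le_div_of_nonneg_right ?_ (by norm_num)
    exact_mod_cast Nat.le_mul_of_pos_right R hs
  have h4 : ((19 : ℝ) / 32) ^ R ≤ Real.exp (-(R / 96)) := by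
    calc ((19 : ℝ) / 32) ^ R ≤ (Real.exp (-(1 / 96))) ^ R :=
          pow_le_pow_left₀ (by norm_num) (by linarith [Real.add_one_le_exp (-(1 / 96) : ℝ)]) R
      _ = Real.exp (-(R / 96)) := by
          rw [← Real.exp_nat_mul]
          congr 1
          ring
  linarith

theorem rpow_le_self_of_one_le {x e : ℝ} (hx : 1 ≤ x) (he : e ≤ 1) : x ^ e ≤ x := by
  simpa using Real.rpow_le_rpow_of_exponent_le hx he

/-- The group size of the estimator with `R` groups. -/
theorem exists_group_size {p : ℝ} (hp : 1 ≤ p) (hp2 : p ≤ 2) {R : ℕ} (hR : 0 < R) {η l : ℝ}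
    (hη : 0 < η) (hl : 0 < l) (hRl : (R : ℝ) ≤ 98 * l) :
    ∃ s : ℕ, 0 < s ∧ 128 * (4608 / (R * s : ℕ) : ℝ) ^ ((2 - p) / p) ≤ s * η ^ 2 ∧
      ((R * s : ℕ) : ℝ) ≤ 57802752 * ((√l / η) ^ p + l) := by
  have hR' : (0 : ℝ) < R := by exact_mod_cast hR
  -- 589824 = 128 · 4608. This X solves X · X^((2-p)/p) = 589824 R/η², the balance between residual
  -- and sampling error. Rounding X/R up to s adds at most R to Rs, whence the additive `l`;
  -- 57802752 = 98 · 589824.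
  set X : ℝ := (589824 * R / η ^ 2) ^ (p / 2) with hX
  have hXpos : 0 < X := Real.rpow_pos_of_pos (by positivity) _
  have hsceil : 0 < ⌈X / R⌉₊ := Nat.ceil_pos.mpr (by positivity)
  set s := ⌈X / R⌉₊
  have hs' : (0 : ℝ) < s := by exact_mod_cast hsceil
  have hXs : X ≤ R * s := by
    have := Nat.le_ceil (X / R)
    rwa [div_le_iff₀ hR', mul_comm] at this
  have hsX : (R : ℝ) * s ≤ X + R := by
    have := (Nat.ceil_lt_add_one (by positivity : 0 ≤ X / R)).le
    calc (R : ℝ) * s ≤ R * (X / R + 1) := mul_le_mul_of_nonneg_left this hR'.le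
      _ = X + R := by field_simp
  have he0 : 0 ≤ (2 - p) / p := div_nonneg (by linarith) (by linarith)
  have he1 : (2 - p) / p ≤ 1 := by rw [div_le_one] <;> linarith
  refine ⟨s, hsceil, ?_, ?_⟩
  · have h1 : 589824 * R / η ^ 2 ≤ (R * s : ℝ) * (R * s : ℝ) ^ ((2 - p) / p) := by
      calc 589824 * R / η ^ 2 = X ^ (2 / p) := by
            rw [hX, ← Real.rpow_mul (by positivity), div_mul_div_cancel₀ (by norm_num),
              div_self (by linarith), Real.rpow_one]
        _ ≤ (R * s : ℝ) ^ (2 / p) := Real.rpow_le_rpow hXpos.le hXs (by positivity)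
        _ = (R * s : ℝ) ^ (1 + (2 - p) / p) := by
            congr 1
            field_simp
            ring
        _ = _ := by rw [Real.rpow_add (by positivity), Real.rpow_one]
    set Y := (R * s : ℝ) ^ ((2 - p) / p) with hY
    have hYpos : 0 < Y := Real.rpow_pos_of_pos (by positivity) _
    have h2 : 589824 ≤ s * η ^ 2 * Y := by
      rw [div_le_iff₀ (by positivity)] at h1
      have : (R : ℝ) * 589824 ≤ R * (s * η ^ 2 * Y) := by linarith
      exact le_of_mul_le_mul_left this hR'
    rw [Nat.cast_mul, Real.div_rpow (by norm_num) (by positivity), ← hY, ← mul_div_assoc,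
      div_le_iff₀ hYpos]
    have h3 := rpow_le_self_of_one_le (x := 4608) (by norm_num) he1
    linarith
  · have hXle : X ≤ 57802752 * (√l / η) ^ p := by
      calc X ≤ (57802752 * (√l / η) ^ 2) ^ (p / 2) := by
            refine Real.rpow_le_rpow (by positivity) ?_ (by linarith)
            rw [div_pow, Real.sq_sqrt hl.le, ← mul_div_assoc]
            exact div_le_div_of_nonneg_right (by linarith) (by positivity)
        _ = 57802752 ^ (p / 2) * (√l / η) ^ p := by
            rw [Real.mul_rpow (by norm_num) (by positivity), ← Real.rpow_natCast,
              ← Real.rpow_mul (by positivity)]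
            congr 2
            push_cast
            ring
        _ ≤ _ := mul_le_mul_of_nonneg_right
            (rpow_le_self_of_one_le (by norm_num) (by linarith)) (by positivity)
    push_cast
    linarith

/-- Trace estimation for a single matrix of Schatten norm at most `1`. -/
theorem exists_trace_estimator : ∃ C : ℝ, 0 < C ∧ ∀ (n : ℕ) (p η δ : ℝ), 1 ≤ p → p ≤ 2 →
    0 < η → 0 < δ → δ < 1 → ∃ (Ω : Type) (_ : Fintype Ω) (_ : Nonempty Ω)
      (est : Ω → QueryProgram n Unit ℝ), ∀ B : Matrix (Fin n) (Fin n) ℝ,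
      (∑ k, sv B k ^ p ≤ 1 →
        𝔼 ω, (if |(est ω).result (fun _ => B) - B.trace| ≤ η then (0 : ℝ) else 1) ≤ δ) ∧
      ∀ ω, ((est ω).cost (fun _ => B) : ℝ) ≤
        C * ((√(Real.log (2 / δ)) / η) ^ p + Real.log (2 / δ)) := by
  refine ⟨3 * 57802752, by norm_num, fun n p η δ hp hp2 hη hδ hδ1 => ?_⟩
  set l := Real.log (2 / δ) with hl
  have hl2 : 1 / 2 < l := by
    have h2 : Real.log 2 < l :=
      Real.log_lt_log (by norm_num) (by rw [lt_div_iff₀ hδ]; linarith)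
    linarith [Real.log_two_gt_d9]
  set R := ⌈96 * l⌉₊
  have hR : 0 < R := Nat.ceil_pos.mpr (by linarith)
  have hRl : (R : ℝ) ≤ 98 * l := by
    have := (Nat.ceil_lt_add_one (by linarith : 0 ≤ 96 * l)).le
    linarith
  obtain ⟨s, hs, hθ, hcost⟩ := exists_group_size hp hp2 hR hη (by linarith : 0 < l) hRl
  refine ⟨_, inferInstance, inferInstance, traceProgram (n := n) R s η, fun B => ⟨fun h => ?_,
    fun ω => ?_⟩⟩
  · refine (expect_traceProgram_bad_le hp hp2 hR hs hη hθ h).trans ?_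
    have h1 : Real.exp (-(R / 96)) ≤ Real.exp (-l) := by
      rw [Real.exp_le_exp, neg_le_neg_iff, le_div_iff₀ (by norm_num), mul_comm]
      exact Nat.le_ceil _
    rw [Real.exp_neg l, hl, Real.exp_log (by positivity), inv_div] at h1
    linarith
  · rw [cost_traceProgram, Nat.cast_mul, Nat.cast_ofNat, mul_assoc]
    exact mul_le_mul_of_nonneg_left hcost (by norm_num)

end Programs
-- The dyadic scheme on the stream: accuracy and number of queries.
section Stream

open Matrix Finset QueryProgram
open scoped BigOperators

variable {n m : ℕ}

/-- Independent uniform seeds for finitely many levels. -/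
theorem exists_seed_measure {k : ℕ} (Ω : Fin k → Type) [∀ l, Fintype (Ω l)]
    [∀ l, Nonempty (Ω l)] :
    ∃ (_ : MeasurableSpace (∀ l, Ω l)) (P : Measure (∀ l, Ω l)), IsProbabilityMeasure P ∧
      (∀ s : Set (∀ l, Ω l), MeasurableSet s) ∧
      ∀ (l : Fin k) (bad : Ω l → Prop) [DecidablePred bad],
        P.real {ω | bad (ω l)} = 𝔼 x, (if bad x then (1 : ℝ) else 0) := by
  let _ : ∀ l, MeasurableSpace (Ω l) := fun _ => ⊤
  have : ∀ l, DiscreteMeasurableSpace (Ω l) := fun _ => ⟨fun _ => trivial⟩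
  refine ⟨inferInstance, Measure.pi fun l => ProbabilityTheory.uniformOn Set.univ, inferInstance,
    fun s => (Set.toFinite s).measurableSet, fun l bad _ => ?_⟩
  have h := (measurePreserving_eval
    (fun l => ProbabilityTheory.uniformOn (Set.univ : Set (Ω l))) l).measure_preimage
    (MeasurableSet.of_discrete (s := {x | bad x})).nullMeasurableSet
  rw [measureReal_def]
  change (Measure.pi _ (Function.eval l ⁻¹' {x | bad x})).toReal = _
  rw [h, ProbabilityTheory.uniformOn_univ, Fintype.expect_eq_sum_div_card,
    Measure.count_apply_finite _ (Set.toFinite _), ENNReal.toReal_div]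
  simp

/-- The largest `l ≤ K` such that `2 ^ l` divides `i`. -/
def dyadicLevel (K i : ℕ) : Fin (K + 1) :=
  ⟨Nat.findGreatest (fun l => 2 ^ l ∣ i) K, Nat.lt_succ_of_le (Nat.findGreatest_le K)⟩

theorem pow_dyadicLevel_dvd (K i : ℕ) : 2 ^ (dyadicLevel K i : ℕ) ∣ i :=
  Nat.findGreatest_spec (P := fun l => 2 ^ l ∣ i) (Nat.zero_le K) (by simp)

/-- Index 0 has level `K`, so a lower level means a positive index, and the subtraction in
`predecessor` is not truncated. -/
theorem pow_dyadicLevel_le {K i : ℕ} (h : (dyadicLevel K i : ℕ) < K) :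
    2 ^ (dyadicLevel K i : ℕ) ≤ i := by
  refine Nat.le_of_dvd (Nat.pos_of_ne_zero ?_) (pow_dyadicLevel_dvd K i)
  rintro rfl
  exact Nat.findGreatest_is_greatest (P := fun l => 2 ^ l ∣ 0) (n := K) h le_rfl (dvd_zero _)

/-- Below level `K`, i is an odd multiple of 2^l, so i - 2^l is an even one. This bounds the length
of a chain of updates. -/
theorem dyadicLevel_sub_lt {K i : ℕ} (h : (dyadicLevel K i : ℕ) < K) :
    (dyadicLevel K i : ℕ) < dyadicLevel K (i - 2 ^ (dyadicLevel K i : ℕ)) := by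
  refine Nat.lt_of_succ_le (Nat.le_findGreatest h ?_)
  have hn : ¬ 2 ^ ((dyadicLevel K i : ℕ) + 1) ∣ i :=
    Nat.findGreatest_is_greatest (P := fun l => 2 ^ l ∣ i) (n := K) (Nat.lt_succ_self _) h
  obtain ⟨q, hq⟩ := pow_dyadicLevel_dvd K i
  set d := 2 ^ (dyadicLevel K i : ℕ)
  rw [Nat.succ_eq_add_one, pow_succ] at *
  have hodd : q % 2 = 1 := by
    rcases Nat.mod_two_eq_zero_or_one q with h0 | h0
    · exfalso
      apply hn
      exact (Nat.mul_dvd_mul_left d (Nat.dvd_of_mod_eq_zero h0)).trans (dvd_of_eq hq.symm)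
    · exact h0
  have : i - d = d * (q - 1) := by
    rw [hq, Nat.mul_sub, mul_one]
  rw [this]
  exact Nat.mul_dvd_mul_left d (by omega)

theorem card_dyadicLevel_le (m K : ℕ) (l : Fin (K + 1)) :
    (#{i : Fin m | dyadicLevel K i = l} : ℝ) ≤ m / 2 ^ (l : ℕ) + 1 := by
  have h : #{i : Fin m | dyadicLevel K i = l} ≤ #(Finset.range (m / 2 ^ (l : ℕ) + 1)) := by
    refine Finset.card_le_card_of_injOn (fun i => (i : ℕ) / 2 ^ (l : ℕ)) ?_ ?_
    · intro i _
      simp only [Finset.coe_range, Set.mem_Iio]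
      exact Nat.lt_succ_of_le (Nat.div_le_div_right i.2.le)
    · intro i hi j hj hij
      simp only [Finset.coe_filter, Finset.mem_univ, true_and, Set.mem_ofPred_eq] at hi hj
      have h1 := pow_dyadicLevel_dvd K i
      have h2 := pow_dyadicLevel_dvd K j
      rw [hi] at h1
      rw [hj] at h2
      exact Fin.ext (Nat.div_left_inj h1 h2 |>.mp hij)
  rw [Finset.card_range] at h
  calc (#{i : Fin m | dyadicLevel K i = l} : ℝ) ≤ ((m / 2 ^ (l : ℕ) + 1 : ℕ) : ℝ) := by
        exact_mod_cast h
    _ ≤ m / 2 ^ (l : ℕ) + 1 := by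
        have := Nat.cast_div_le (α := ℝ) (m := m) (n := 2 ^ (l : ℕ))
        push_cast at this ⊢
        linarith

/-- The bound on the Schatten norm of the matrix whose trace is estimated at level `l`. -/
noncomputable def levelScale (K : ℕ) (α : ℝ) (l : Fin (K + 1)) : ℝ :=
  if (l : ℕ) = K then 1 else 2 ^ (l : ℕ) * α

/-- The position from which the estimate in step `i` is updated. -/
def predecessor (K : ℕ) (i : Fin m) : Fin m :=
  ⟨i - 2 ^ (dyadicLevel K i : ℕ), (Nat.sub_le _ _).trans_lt i.2⟩

theorem predecessor_le (K : ℕ) (i : Fin m) : predecessor K i ≤ i := Nat.sub_le _ _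

/-- The matrix whose trace is estimated in step `i`. -/
noncomputable def increment (K : ℕ) (α : ℝ) (A : Fin m → Matrix (Fin n) (Fin n) ℝ) (i : Fin m) :
    Matrix (Fin n) (Fin n) ℝ :=
  if (dyadicLevel K i : ℕ) = K then A i
  else (levelScale K α (dyadicLevel K i))⁻¹ • (A i - A (predecessor K i))

/-- Matrix-vector products with `increment K α A i`. -/
noncomputable def incrementProgram (K : ℕ) (α : ℝ) (i : Fin m) (x : Fin n → ℝ) :
    QueryProgram n {j : Fin m // j ≤ i} (Fin n → ℝ) :=
  query ⟨i, le_rfl⟩ x fun a =>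
    if (dyadicLevel K i : ℕ) = K then ret a
    else query ⟨predecessor K i, predecessor_le K i⟩ x fun b =>
      ret ((levelScale K α (dyadicLevel K i))⁻¹ • (a - b))

theorem result_incrementProgram (K : ℕ) (α : ℝ) (A : Fin m → Matrix (Fin n) (Fin n) ℝ)
    (i : Fin m) (x : Fin n → ℝ) :
    (incrementProgram K α i x).result (fun j => A j.1) = increment K α A i *ᵥ x := by
  rw [incrementProgram, increment, result]
  split_ifs
  · rfl
  · simp only [result]
    rw [Matrix.smul_mulVec, Matrix.sub_mulVec]

theorem cost_incrementProgram_le (K : ℕ) (α : ℝ) (A : Fin m → Matrix (Fin n) (Fin n) ℝ)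
    (i : Fin m) (x : Fin n → ℝ) :
    (incrementProgram K α i x).cost (fun j => A j.1) ≤ 2 := by
  rw [incrementProgram, cost]
  split_ifs <;> simp [cost]

/-- The streaming algorithm that estimates traces of dyadic increments by the programs `e l` and
restarts every `2 ^ K` steps. -/
noncomputable def dyadicAlgorithm (m K : ℕ) (α : ℝ) (e : Fin (K + 1) → QueryProgram n Unit ℝ) :
    StreamAlgorithm n m where
  Mem := ℕ → ℝ
  init := 0
  step i mem :=
    ((e (dyadicLevel K i)).simulate (incrementProgram K α i)).bind fun v =>
      ret (Function.update mem i
          ((if (dyadicLevel K i : ℕ) = K then 0 else mem (predecessor K i)) +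
            levelScale K α (dyadicLevel K i) * v),
        (if (dyadicLevel K i : ℕ) = K then 0 else mem (predecessor K i)) +
          levelScale K α (dyadicLevel K i) * v)

variable {K : ℕ} {α : ℝ}

theorem memory_dyadicAlgorithm (e : Fin (K + 1) → QueryProgram n Unit ℝ)
    (A : Fin m → Matrix (Fin n) (Fin n) ℝ) :
    ∀ (k : ℕ) (j : Fin m), (j : ℕ) < k →
      ((dyadicAlgorithm m K α e).memory A k : ℕ → ℝ) j = (dyadicAlgorithm m K α e).output A j
  | 0, _, h => absurd h (Nat.not_lt_zero _)
  | k + 1, j, h => by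
    by_cases hk : k < m
    · have hmem : ((dyadicAlgorithm m K α e).memory A (k + 1) : ℕ → ℝ) =
          Function.update ((dyadicAlgorithm m K α e).memory A k : ℕ → ℝ) k
            ((dyadicAlgorithm m K α e).output A ⟨k, hk⟩) := by
        rw [StreamAlgorithm.memory, dif_pos hk]
        simp only [StreamAlgorithm.output, dyadicAlgorithm, result_bind, result]
      rcases (Nat.lt_succ_iff_lt_or_eq.mp h) with hj | hj
      · exact (congrFun hmem j).trans ((Function.update_of_ne hj.ne _ _).trans
          (memory_dyadicAlgorithm e A k j hj))
      · have : j = ⟨k, hk⟩ := Fin.ext hj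
        subst this
        exact (congrFun hmem k).trans (Function.update_self _ _ _)
    · rw [StreamAlgorithm.memory, dif_neg hk]
      exact memory_dyadicAlgorithm e A k j (j.2.trans_le (not_lt.mp hk))

theorem output_dyadicAlgorithm (e : Fin (K + 1) → QueryProgram n Unit ℝ)
    (A : Fin m → Matrix (Fin n) (Fin n) ℝ) (i : Fin m) :
    (dyadicAlgorithm m K α e).output A i =
      (if (dyadicLevel K i : ℕ) = K then 0
        else (dyadicAlgorithm m K α e).output A (predecessor K i)) +
      levelScale K α (dyadicLevel K i) *
        (e (dyadicLevel K i)).result (fun _ => increment K α A i) := by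
  have h : (dyadicAlgorithm m K α e).output A i =
      (if (dyadicLevel K i : ℕ) = K then 0
        else ((dyadicAlgorithm m K α e).memory A i : ℕ → ℝ) (predecessor K i)) +
      levelScale K α (dyadicLevel K i) *
        (e (dyadicLevel K i)).result (fun _ => increment K α A i) := by
    simp only [StreamAlgorithm.output, dyadicAlgorithm, result_bind, result]
    rw [result_simulate _ _ _ (result_incrementProgram K α A i)]
  rw [h]
  split_ifs with hK
  · rfl
  · rw [memory_dyadicAlgorithm]
    have hlt : (dyadicLevel K i : ℕ) < K :=
      lt_of_le_of_ne (Nat.lt_succ_iff.mp (dyadicLevel K i).2) hK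
    exact Nat.sub_lt_of_pos_le (by positivity) (pow_dyadicLevel_le hlt)

theorem queries_dyadicAlgorithm_le (e : Fin (K + 1) → QueryProgram n Unit ℝ)
    (A : Fin m → Matrix (Fin n) (Fin n) ℝ) :
    (dyadicAlgorithm m K α e).queries A ≤
      ∑ i : Fin m, 2 * (e (dyadicLevel K i)).cost (fun _ => increment K α A i) := by
  refine Finset.sum_le_sum fun i _ => ?_
  simp only [dyadicAlgorithm, cost_bind, cost, add_zero]
  exact cost_simulate_le _ _ _ (result_incrementProgram K α A i) 2
    (cost_incrementProgram_le K α A i) _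

theorem schattenNorm_sub_le {p : ℝ} (hp : 1 ≤ p) {A : Fin m → Matrix (Fin n) (Fin n) ℝ}
    (hA : ∀ i j : Fin m, (i : ℕ) + 1 = (j : ℕ) → schattenNorm p (A j - A i) ≤ α) :
    ∀ (d : ℕ) (i j : Fin m), (i : ℕ) + (d + 1) = (j : ℕ) →
      schattenNorm p (A j - A i) ≤ ((d + 1 : ℕ) : ℝ) * α
  | 0, i, j, h => by simpa using hA i j h
  | d + 1, i, j, h => by
    have hm : (i : ℕ) + (d + 1) < m := by have := j.2; omega
    have h1 := schattenNorm_sub_le hp hA d i ⟨i + (d + 1), hm⟩ rfl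
    have h2 := hA ⟨i + (d + 1), hm⟩ j (by simp only; omega)
    have h3 := schattenNorm_add_le hp (A j - A ⟨i + (d + 1), hm⟩) (A ⟨i + (d + 1), hm⟩ - A i)
    rw [sub_add_sub_cancel] at h3
    push_cast at h1 ⊢
    linarith

theorem levelScale_pos (hα : 0 < α) (l : Fin (K + 1)) : 0 < levelScale K α l := by
  unfold levelScale; split_ifs <;> positivity

theorem sum_sv_increment_le {p : ℝ} (hp : 1 ≤ p) (hα : 0 < α)
    {A : Fin m → Matrix (Fin n) (Fin n) ℝ} (hA1 : ∀ i : Fin m, schattenNorm p (A i) ≤ 1)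
    (hA : ∀ i j : Fin m, (i : ℕ) + 1 = (j : ℕ) → schattenNorm p (A j - A i) ≤ α) (i : Fin m) :
    ∑ k, sv (increment K α A i) k ^ p ≤ 1 := by
  unfold increment
  split_ifs with h
  · have := (schattenNorm_le_iff hp zero_le_one).mp (hA1 i)
    rwa [Real.one_rpow] at this
  · have hlt : (dyadicLevel K i : ℕ) < K :=
      lt_of_le_of_ne (Nat.lt_succ_iff.mp (dyadicLevel K i).2) h
    have hβ := levelScale_pos hα (dyadicLevel K i)
    have hle := pow_dyadicLevel_le hlt
    have hpos : 0 < 2 ^ (dyadicLevel K i : ℕ) := by positivity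
    have h1 := schattenNorm_sub_le hp hA (2 ^ (dyadicLevel K i : ℕ) - 1) (predecessor K i) i
      (by simp only [predecessor]; omega)
    rw [Nat.sub_add_cancel hpos] at h1
    have h2 : schattenNorm p (A i - A (predecessor K i)) ≤ levelScale K α (dyadicLevel K i) := by
      rw [levelScale, if_neg h]
      push_cast at h1
      exact h1
    refine (sum_sv_rpow_smul_le hp (inv_nonneg.mpr hβ.le) _).trans ?_
    refine (mul_le_mul_of_nonneg_left ((schattenNorm_le_iff hp hβ.le).mp h2)
      (Real.rpow_nonneg (inv_nonneg.mpr hβ.le) p)).trans ?_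
    rw [← Real.mul_rpow (inv_nonneg.mpr hβ.le) hβ.le, inv_mul_cancel₀ hβ.ne', Real.one_rpow]

theorem trace_eq_add_increment (hα : 0 < α) (A : Fin m → Matrix (Fin n) (Fin n) ℝ) (i : Fin m) :
    (A i).trace = (if (dyadicLevel K i : ℕ) = K then 0 else (A (predecessor K i)).trace) +
      levelScale K α (dyadicLevel K i) * (increment K α A i).trace := by
  have hβ := levelScale_pos hα (dyadicLevel K i)
  unfold increment
  split_ifs with h
  · simp [levelScale, h]
  · rw [Matrix.trace_smul, smul_eq_mul, mul_inv_cancel_left₀ hβ.ne', Matrix.trace_sub]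
    ring

/-- The error analysis of the dyadic algorithm. -/
theorem measureReal_output_bad_le {Ω : Type} [MeasurableSpace Ω] (P : Measure Ω)
    [IsFiniteMeasure P] (hα : 0 < α) (e : Ω → Fin (K + 1) → QueryProgram n Unit ℝ)
    (A : Fin m → Matrix (Fin n) (Fin n) ℝ) {τ ρ : ℝ} (hτ : 0 ≤ τ) (hρ : 0 ≤ ρ)
    (hbad : ∀ i : Fin m, P.real {ω | ¬ |(e ω (dyadicLevel K i)).result
      (fun _ => increment K α A i) - (increment K α A i).trace| ≤
        τ / levelScale K α (dyadicLevel K i)} ≤ ρ) (i : Fin m) :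
    P.real {ω | ¬ |(dyadicAlgorithm m K α (e ω)).output A i - (A i).trace| ≤
      ((K + 1 - dyadicLevel K i : ℕ) : ℝ) * τ} ≤ ((K + 1 - dyadicLevel K i : ℕ) : ℝ) * ρ := by
  have hβ := levelScale_pos hα (dyadicLevel K i)
  have hstep : ∀ ω, |(e ω (dyadicLevel K i)).result (fun _ => increment K α A i) -
      (increment K α A i).trace| ≤ τ / levelScale K α (dyadicLevel K i) →
      |levelScale K α (dyadicLevel K i) * (e ω (dyadicLevel K i)).result
        (fun _ => increment K α A i) -
        levelScale K α (dyadicLevel K i) * (increment K α A i).trace| ≤ τ := by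
    intro ω h
    rw [← mul_sub, abs_mul, abs_of_pos hβ]
    rwa [le_div_iff₀' hβ] at h
  by_cases hK : (dyadicLevel K i : ℕ) = K
  · rw [hK, Nat.add_sub_cancel_left, Nat.cast_one, one_mul, one_mul]
    refine (measureReal_mono fun ω hω => ?_).trans (hbad i)
    simp only [Set.mem_ofPred_eq] at hω ⊢
    contrapose! hω
    have := hstep ω hω
    rw [output_dyadicAlgorithm, trace_eq_add_increment (K := K) hα A i, if_pos hK, if_pos hK,
      zero_add, zero_add]
    exact this
  · have hlt : (dyadicLevel K i : ℕ) < K :=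
      lt_of_le_of_ne (Nat.lt_succ_iff.mp (dyadicLevel K i).2) hK
    have hdec : (predecessor K i : ℕ) < i :=
      Nat.sub_lt_of_pos_le (by positivity) (pow_dyadicLevel_le hlt)
    have ih := measureReal_output_bad_le P hα e A hτ hρ hbad (predecessor K i)
    have hl : (dyadicLevel K i : ℕ) < dyadicLevel K (predecessor K i) := dyadicLevel_sub_lt hlt
    -- `K + 1 - dyadicLevel K i` bounds the number of links from `i` to a fresh estimate. Only a
    -- union bound follows, so steps of one level may share a seed.
    have hcnt : (((K + 1 - dyadicLevel K (predecessor K i) : ℕ) : ℝ)) + 1 ≤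
        ((K + 1 - dyadicLevel K i : ℕ) : ℝ) := by
      have : K + 1 - (dyadicLevel K (predecessor K i) : ℕ) + 1 ≤ K + 1 - dyadicLevel K i := by
        have := (dyadicLevel K (predecessor K i)).2
        omega
      exact_mod_cast this
    refine le_trans (measureReal_mono (fun ω hω => ?_) (measure_ne_top _ _))
      ((measureReal_union_le _ _).trans ((add_le_add ih (hbad i)).trans ?_))
    · simp only [Set.mem_union, Set.mem_ofPred_eq] at hω ⊢
      by_contra! hcon
      apply hω
      have h1 := hstep ω hcon.2
      have h2 := hcon.1
      rw [output_dyadicAlgorithm, trace_eq_add_increment (K := K) hα A i, if_neg hK, if_neg hK,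
        add_sub_add_comm]
      refine (abs_add_le _ _).trans ((add_le_add h2 h1).trans ?_)
      nlinarith [mul_le_mul_of_nonneg_right hcnt hτ]
    · nlinarith [mul_le_mul_of_nonneg_right hcnt hρ]
termination_by (i : ℕ)

theorem sum_levelScale_rpow_le {p : ℝ} (hp : 1 ≤ p) (hα : 0 < α) (hK : 2 ^ K ≤ 1 / α)
    (hK' : 1 / α < 2 ^ (K + 1)) (m : ℕ) :
    ∑ i : Fin m, levelScale K α (dyadicLevel K i) ^ p ≤ 2 * (K + 1) * (m * α + 1) := by
  rw [le_div_iff₀ hα] at hK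
  rw [div_lt_iff₀ hα, pow_succ] at hK'
  have hle1 : ∀ l : Fin (K + 1), 2 ^ (l : ℕ) * α ≤ 1 := fun l =>
    (mul_le_mul_of_nonneg_right (pow_le_pow_right₀ (by norm_num)
      (Nat.lt_succ_iff.mp l.2)) hα.le).trans hK
  have hterm : ∀ l : Fin (K + 1), (#{i : Fin m | dyadicLevel K i = l} : ℝ) * levelScale K α l ^ p ≤
      2 * (m * α + 1) := by
    intro l
    have hβ := levelScale_pos hα l
    have hβ1 : levelScale K α l ≤ 1 := by
      unfold levelScale
      split_ifs
      · rfl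
      · exact hle1 l
    -- This is where p ≥ 1 enters: the factor 2^l in the scale then cancels the frequency m/2^l of
    -- the level.
    have hβp : levelScale K α l ^ p ≤ levelScale K α l := by
      simpa using Real.rpow_le_rpow_of_exponent_ge hβ hβ1 hp
    refine (mul_le_mul (card_dyadicLevel_le m K l) hβp (Real.rpow_nonneg hβ.le p)
      (by positivity)).trans ?_
    have hm : (0 : ℝ) ≤ m := Nat.cast_nonneg m
    unfold levelScale
    split_ifs with h
    · rw [h, mul_one]
      have : (m : ℝ) / 2 ^ K ≤ 2 * (m * α) := by
        rw [div_le_iff₀ (by positivity)]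
        nlinarith [mul_le_mul_of_nonneg_left hK'.le hm]
      linarith
    · have : ((m : ℝ) / 2 ^ (l : ℕ) + 1) * (2 ^ (l : ℕ) * α) = m * α + 2 ^ (l : ℕ) * α := by
        field_simp
      rw [this]
      have := hle1 l
      have : 0 ≤ m * α := by positivity
      linarith
  rw [← Finset.sum_fiberwise (s := univ) (g := fun i : Fin m => dyadicLevel K i)]
  calc ∑ l, ∑ i ∈ ({i : Fin m | dyadicLevel K i = l} : Finset (Fin m)),
        levelScale K α (dyadicLevel K i) ^ p
      = ∑ l, (#{i : Fin m | dyadicLevel K i = l} : ℝ) * levelScale K α l ^ p := by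
        refine Finset.sum_congr rfl fun l _ => ?_
        rw [Finset.sum_congr rfl (g := fun _ => levelScale K α l ^ p), Finset.sum_const,
          nsmul_eq_mul]
        intro i hi
        rw [(Finset.mem_filter.mp hi).2]
    _ ≤ ∑ _l : Fin (K + 1), 2 * (m * α + 1) := Finset.sum_le_sum fun l _ => hterm l
    _ = 2 * (K + 1) * (m * α + 1) := by
        rw [Finset.sum_const, Finset.card_univ, Fintype.card_fin, nsmul_eq_mul]
        push_cast
        ring

theorem log_two_le_truncLog (x : ℝ) : Real.log 2 ≤ truncLog x :=
  Real.log_le_log (by norm_num) (le_max_left _ _)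

theorem truncLog_pos (x : ℝ) : 0 < truncLog x :=
  (Real.log_pos (by norm_num)).trans_le (log_two_le_truncLog x)

theorem levels_le_truncLog {x : ℝ} (hK : 2 ^ K ≤ x) : (K : ℝ) + 1 ≤ 3 * truncLog x := by
  have h1 : K * Real.log 2 ≤ truncLog x := by
    rw [← Real.log_pow]
    exact Real.log_le_log (by positivity) (hK.trans (le_max_right _ _))
  have h2 := log_two_le_truncLog x
  have h3 : (2 : ℝ) / 3 ≤ Real.log 2 := by linarith [Real.log_two_gt_d9]
  have h4 : ((K : ℝ) + 1) * (2 / 3) ≤ (K + 1) * Real.log 2 :=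
    mul_le_mul_of_nonneg_left h3 (by positivity)
  linarith

/-- Splitting `δ` over the levels costs only a constant factor, because K + 1 ≤ 2^K ≤ 1/α. -/
theorem log_levels_le_truncLog {δ : ℝ} (hα : 0 < α) (hδ : 0 < δ) (hK : 2 ^ K ≤ 1 / α) :
    Real.log (2 / (δ / (K + 1))) ≤ 2 * truncLog (1 / (α * δ)) := by
  set y := 1 / (α * δ) with hy
  have hy0 : 0 < y := by positivity
  have h1 : 2 / (δ / (K + 1)) ≤ 2 * y := by
    have h2 : (K : ℝ) + 1 ≤ 1 / α := by
      refine le_trans ?_ hK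
      exact_mod_cast Nat.lt_two_pow_self
    calc 2 / (δ / (K + 1)) = 2 * (K + 1) / δ := by field_simp
      _ ≤ 2 * (1 / α) / δ := div_le_div_of_nonneg_right (by linarith) hδ.le
      _ = 2 * y := by rw [hy]; field_simp
  have h2 : 2 * y ≤ max 2 y * max 2 y :=
    mul_le_mul (le_max_left _ _) (le_max_right _ _) hy0.le (by positivity)
  have hz : max 2 y ≠ 0 := by positivity
  calc Real.log (2 / (δ / (K + 1))) ≤ Real.log (max 2 y * max 2 y) :=
        Real.log_le_log (by positivity) (h1.trans h2)
    _ = 2 * truncLog y := by rw [Real.log_mul hz hz, truncLog]; ring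

/-- The randomized algorithm that makes no query and outputs `0`. -/
noncomputable def zeroAlgorithm (n m : ℕ) : RandomizedStreamAlgorithm n m where
  Ω := Unit
  P := Measure.dirac ()
  alg _ := { Mem := Unit, init := (), step := fun _ _ => ret ((), 0) }
  measurable_output _ _ := measurable_const

end Stream

/-! ### Assembly of the main theorem. -/

theorem mainTheorem6 :
    ∃ C : ℝ, 0 < C ∧ ∀ (n m : ℕ) (p α δ ε : ℝ), 1 ≤ p → p ≤ 2 → 0 < α → α < 1 → 0 < δ → 0 < ε →
      ∃ R : RandomizedStreamAlgorithm n m, ∀ A : Fin m → Matrix (Fin n) (Fin n) ℝ,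
        (∀ i : Fin m, schattenNorm p (A i) ≤ 1) →
        (∀ i j : Fin m, (i : ℕ) + 1 = (j : ℕ) → schattenNorm p (A j - A i) ≤ α) →
        (∀ i : Fin m, 1 - δ ≤ R.P.real {ω : R.Ω | |(R.alg ω).output A i - (A i).trace| ≤ ε}) ∧
        (∀ ω : R.Ω, ((R.alg ω).queries A : ℝ) ≤
          C * (((m : ℝ) * α + 1) * truncLog (1 / α) ^ (1 + p)
                * (Real.sqrt (truncLog (1 / (α * δ))) / ε) ^ p
              + (m : ℝ) * truncLog (1 / (α * δ)))) := by
  obtain ⟨C, hC, hest⟩ := exists_trace_estimator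
  -- 216 = 2 · 2 · 3 · 18: two stream queries per simulated query, the 2 of
  -- `sum_levelScale_rpow_le`, K + 1 ≤ 3L, and (3√2)^p ≤ 18.
  refine ⟨216 * C, by positivity, fun n m p α δ ε hp hp2 hα hα1 hδ hε => ?_⟩
  have hL0 := truncLog_pos (1 / α)
  have hL1 := truncLog_pos (1 / (α * δ))
  rcases le_or_gt 1 δ with hδ1 | hδ1
  · refine ⟨zeroAlgorithm n m, fun A _ _ =>
      ⟨fun i => (by linarith : 1 - δ ≤ 0).trans measureReal_nonneg, fun ω => ?_⟩⟩
    have h0 : ((zeroAlgorithm n m).alg ω).queries A = 0 :=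
      Finset.sum_eq_zero fun i _ => rfl
    rw [h0, Nat.cast_zero]
    positivity
  obtain ⟨K, hK, hK'⟩ := exists_nat_pow_near (one_le_one_div hα hα1.le) (one_lt_two : (1 : ℝ) < 2)
  have hK1 : (0 : ℝ) < K + 1 := by positivity
  have hβ : ∀ l : Fin (K + 1), 0 < levelScale K α l := levelScale_pos hα
  have hδK : δ / (K + 1) < 1 := by
    rw [div_lt_one hK1]
    linarith [(Nat.cast_nonneg K : (0 : ℝ) ≤ K)]
  -- Increments are rescaled to norm at most 1, so the accuracy ε/(K+1) of a link is divided by the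
  -- scale of its level.
  choose Ω hfin hne est hgood using fun l : Fin (K + 1) =>
    hest n p (ε / (K + 1) / levelScale K α l) (δ / (K + 1)) hp hp2
      (div_pos (div_pos hε hK1) (hβ l)) (div_pos hδ hK1) hδK
  obtain ⟨ms, P, hP, hmeas, hmarg⟩ := exists_seed_measure Ω
  refine ⟨{ Ω := ∀ l, Ω l, P := P, alg := fun ω => dyadicAlgorithm m K α fun l => est l (ω l),
            measurable_output := fun A i s _ => hmeas _ }, fun A hA1 hA => ⟨fun i => ?_,
            fun ω => ?_⟩⟩
  · have h := measureReal_output_bad_le P hα (fun ω l => est l (ω l)) A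
      (div_pos hε hK1).le (div_pos hδ hK1).le (fun i => by
        rw [hmarg (dyadicLevel K i) (fun x => ¬ |(est (dyadicLevel K i) x).result
          (fun _ => increment K α A i) - (increment K α A i).trace| ≤
            ε / (K + 1) / levelScale K α (dyadicLevel K i))]
        refine le_trans (le_of_eq ?_)
          ((hgood (dyadicLevel K i) _).1 (sum_sv_increment_le (K := K) hp hα hA1 hA i))
        exact Finset.expect_congr rfl fun x _ => by split_ifs <;> simp_all) i
    have hcnt : ((K + 1 - dyadicLevel K i : ℕ) : ℝ) ≤ K + 1 := by
      exact_mod_cast Nat.sub_le (K + 1) _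
    have hc : ∀ x : ℝ, 0 < x → ((K + 1 - dyadicLevel K i : ℕ) : ℝ) * (x / (K + 1)) ≤ x := by
      intro x hx
      refine (mul_le_mul_of_nonneg_right hcnt (div_pos hx hK1).le).trans (le_of_eq ?_)
      field_simp
    set S : Set (∀ l, Ω l) := {ω | |(dyadicAlgorithm m K α fun l => est l (ω l)).output A i -
      (A i).trace| ≤ ε} with hS
    have hcompl : P.real Sᶜ ≤ δ := by
      refine le_trans (measureReal_mono fun ω hω => ?_) (h.trans (hc δ hδ))
      simp only [hS, Set.mem_compl_iff, Set.mem_ofPred_eq] at hω ⊢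
      exact fun h1 => hω (h1.trans (hc ε hε))
    rw [probReal_compl_eq_one_sub (hmeas S)] at hcompl
    change 1 - δ ≤ P.real S
    linarith
  · set l := Real.log (2 / (δ / (K + 1))) with hl
    set L := truncLog (1 / α)
    set L' := truncLog (1 / (α * δ))
    have hl2 : l ≤ 2 * L' := log_levels_le_truncLog hα hδ hK
    have hKL : (K : ℝ) + 1 ≤ 3 * L := levels_le_truncLog hK
    set X := (√l * (K + 1) / ε) ^ p with hX
    have hX0 : 0 ≤ X := by positivity
    have hcost : ∀ i : Fin m, ((est (dyadicLevel K i) (ω (dyadicLevel K i))).cost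
        (fun _ => increment K α A i) : ℝ) ≤
        C * (X * levelScale K α (dyadicLevel K i) ^ p + l) := by
      intro i
      refine ((hgood (dyadicLevel K i) _).2 _).trans (le_of_eq ?_)
      rw [hX, ← Real.mul_rpow (by positivity) (hβ _).le]
      congr 3
      have := (hβ (dyadicLevel K i)).ne'
      field_simp
    have hXle : (K + 1) * X ≤ 54 * (L ^ (1 + p) * (√L' / ε) ^ p) := by
      have h1 : X ≤ (18 : ℝ) * (L ^ p * (√L' / ε) ^ p) := by
        have hsq : √l ≤ √2 * √L' := by
          rw [← Real.sqrt_mul (by norm_num)]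
          exact Real.sqrt_le_sqrt hl2
        have h18 : (3 * √2) ^ p ≤ (18 : ℝ) := by
          have h0 : 1 ≤ 3 * √2 := by
            linarith [Real.one_le_sqrt.mpr (by norm_num : (1 : ℝ) ≤ 2)]
          calc (3 * √2) ^ p ≤ (3 * √2) ^ (2 : ℝ) := Real.rpow_le_rpow_of_exponent_le h0 hp2
            _ = 18 := by
              rw [Real.rpow_two, mul_pow, Real.sq_sqrt (by norm_num)]
              norm_num
        calc X ≤ ((3 * √2) * (L * (√L' / ε))) ^ p := by
              refine Real.rpow_le_rpow (by positivity) ?_ (by linarith)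
              calc √l * (K + 1) / ε ≤ (√2 * √L') * (3 * L) / ε := by gcongr
                _ = (3 * √2) * (L * (√L' / ε)) := by ring
          _ = (3 * √2) ^ p * (L ^ p * (√L' / ε) ^ p) := by
              rw [Real.mul_rpow (x := 3 * √2) (by positivity) (by positivity),
                Real.mul_rpow (x := L) hL0.le (by positivity)]
          _ ≤ _ := mul_le_mul_of_nonneg_right h18 (by positivity)
      calc (K + 1) * X ≤ (3 * L) * (18 * (L ^ p * (√L' / ε) ^ p)) :=
            mul_le_mul hKL h1 hX0 (by positivity)
        _ = _ := by
            rw [Real.rpow_add hL0, Real.rpow_one]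
            ring
    have hq := queries_dyadicAlgorithm_le (K := K) (α := α) (fun l => est l (ω l)) A
    have hq' : ((dyadicAlgorithm m K α fun l => est l (ω l)).queries A : ℝ) ≤
        ∑ i : Fin m, 2 * (C * (X * levelScale K α (dyadicLevel K i) ^ p + l)) := by
      refine (Nat.cast_le.mpr hq).trans ?_
      push_cast
      exact Finset.sum_le_sum fun i _ => mul_le_mul_of_nonneg_left (hcost i) (by norm_num)
    refine hq'.trans ?_
    rw [← Finset.mul_sum, ← Finset.mul_sum, Finset.sum_add_distrib, ← Finset.mul_sum,
      Finset.sum_const, Finset.card_univ, Fintype.card_fin, nsmul_eq_mul]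
    have hm : (0 : ℝ) ≤ m := Nat.cast_nonneg m
    have h1 := mul_le_mul_of_nonneg_left (sum_levelScale_rpow_le hp hα hK hK' m) hX0
    have h2 : X * (2 * (K + 1) * (m * α + 1)) ≤
        108 * ((m * α + 1) * L ^ (1 + p) * (√L' / ε) ^ p) := by
      have := mul_le_mul_of_nonneg_left hXle (by positivity : (0 : ℝ) ≤ 2 * (m * α + 1))
      linarith
    have h3 : m * l ≤ 108 * (m * L') := by
      have := mul_le_mul_of_nonneg_left hl2 hm
      have : 0 ≤ m * L' := by positivity
      linarith
    have h4 := mul_le_mul_of_nonneg_left (add_le_add (h1.trans h2) h3) hC.le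
    linarith
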